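/- Let $\theta\in\mathbb R$, $\lambda=e^{2\pi i\theta}$, $\mu=e^{\pi i\theta}$. Let $\mathcal A(S^4_\theta)$ be the unital complex $*$-algebra generated by $\alpha,\beta$ and a central $x=x^*$ with relations $\alpha\beta=\lambda\beta\alpha$, $\alpha\beta^*=\bar\lambda\beta^*\alpha$, $\alpha\alpha^*=\alpha^*\alpha$, $\beta\beta^*=\beta^*\beta$, $\alpha\alpha^*+\beta\beta^*+x^2=1$. Let $\mathcal A(S^7_{\theta'})$ be the unital complex $*$-algebra generated by $z^1,\dots,z^4$, with $\bar z^i=(z^i)^*$, and relations $z^iz^j=\lambda'^{ij}z^jz^i$, $\bar z^iz^j=\lambda'^{ji}z^j\bar z^i$, $\bar z^i\bar z^j=\lambda'^{ij}\bar z^j\bar z^i$, $\sum_iz^i\bar z^i=1$, where $\lambda'^{ij}=1$ if $i,j\in\{1,2\}$ or $i,j\in\{3,4\}$, $\lambda'^{ij}=\mu$ if $i\in\{1,2\},j\in\{3,4\}$, and $\lambda'^{ij}=\bar\mu$ if $i\in\{3,4\},j\in\{1,2\}$. The group $SU(2)$ acts on $\mathcal A(S^7_{\theta'})$ by the automorphisms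 $\alpha_w:(z^1,z^2,z^3,z^4)\mapsto(z^1,z^2,z^3,z^4)\begin{pmatrix}w&0\\0&w\end{pmatrix}$. The assignments $\alpha\mapsto2(z^1\bar z^3+z^2\bar z^4)$, $\beta\mapsto2(-z^1z^4+z^2z^3)$, $x\mapsto z^1\bar z^1+z^2\bar z^2-z^3\bar z^3-z^4\bar z^4$ define an injective homomorphism of $*$-algebras $\mathcal A(S^4_\theta)\to\mathcal A(S^7_{\theta'})$ with $SU(2)$-invariant values, by which $\mathcal A(S^4_\theta)$ is regarded as a subalgebra of $\mathcal A(S^7_{\theta'})$. Let $n\ge0$ be an integer and $V^{(n)}=\mathrm{Sym}^n(\mathbb C^2)$, on which $SU(2)$ acts from the right by $\rho_n(w)$, the $n$-th symmetric power of the action $v\mapsto vw$ on row vectors $v\in\mathbb C^2$ (so $e_a\mapsto\sum_bw_{ab}e_b$). Let $\mathrm{Hom}_{\rho_n}(V^{(n)},\mathcal A(S^7_{\theta'}))$ be the space of coequivariant maps, i.e. of $\mathbb C$-linear maps $\phi:V^{(n)}\to\mathcal A(S^7_{\theta'})$ with $$\phi\big(v\cdot\rho_n(w)^{-1}\big)=\alpha_w(\phi(v))\qquad(w\in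 SU(2),\ v\in V^{(n)}),$$ a right $\mathcal A(S^4_\theta)$-module by $(\phi\cdot a)(v)=\phi(v)a$. Put $|\psi_1\rangle=(z^1,-\bar z^2,z^3,-\bar z^4)^t$, $|\psi_2\rangle=(z^2,\bar z^1,z^4,\bar z^3)^t$, and for $k=1,\dots,n+1$, with $a_k=\binom n{k-1}^{1/2}$, $$|\phi_k\rangle=\frac1{a_k}\sum_{c}|\psi_{c_1}\rangle\otimes\cdots\otimes|\psi_{c_n}\rangle\in\mathcal A(S^7_{\theta'})^{4^n},\qquad e_k=\frac1{a_k}\sum_{c}e_{c_1}\cdots e_{c_n}\in V^{(n)},$$ where $c$ runs over the words $c\in\{1,2\}^n$ in which $2$ occurs exactly $k-1$ times, and $(|\xi_1\rangle\otimes\cdots\otimes|\xi_n\rangle)_{i_1\dots i_n}=(\xi_1)_{i_1}\cdots(\xi_n)_{i_n}$. For $|f\rangle\in\mathcal A(S^4_\theta)^{4^n}$ let $\langle\phi_k|f\rangle=\sum_i(\phi_k)_i^*f_i$. Then the matrix $p_{(n)}=\sum_{k=1}^{n+1}|\phi_k\rangle\langle\phi_k|$ has its entries in $\mathcal A(S^4_\theta)$,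 it is a projection, $p_{(n)}^2=p_{(n)}=p_{(n)}^*$, and there is an isomorphism of right $\mathcal A(S^4_\theta)$-modules $$p_{(n)}\big(\mathcal A(S^4_\theta)^{4^n}\big)\;\cong\;\mathrm{Hom}_{\rho_n}\big(V^{(n)},\mathcal A(S^7_{\theta'})\big),\qquad p_{(n)}|f\rangle\mapsto\big(e_k\mapsto\langle\phi_k|f\rangle\big).$$ -/

import Mathlib

open scoped TensorProduct Matrix

noncomputable section

namespace NCHopf

/-! ### Conjugate-linear anti-multiplicative maps -/

/-- The opposite algebra of `A` with the conjugate scalar multiplication.  An algebra map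
`A → ConjOp A` is the same as a conjugate-linear antimultiplicative unital map `A → A`. -/
def ConjOp (A : Type) : Type := Aᵐᵒᵖ

instance (A : Type) [Ring A] : Ring (ConjOp A) := inferInstanceAs (Ring Aᵐᵒᵖ)

instance (A : Type) [Ring A] [Algebra ℂ A] : Algebra ℂ (ConjOp A) :=
  Algebra.compHom Aᵐᵒᵖ (starRingEnd ℂ)

/-- The tautological map `A → ConjOp A`. -/
def toConj {A : Type} (a : A) : ConjOp A := MulOpposite.op a

/-- The tautological map `ConjOp A → A`. -/
def ofConj {A : Type} (a : ConjOp A) : A := MulOpposite.unop a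

section Conj

variable {A : Type}

@[simp] theorem ofConj_toConj (a : A) : ofConj (toConj a) = a := rfl
theorem toConj_inj {a b : A} (h : a = b) : toConj a = toConj b := by rw [h]

variable [Ring A]

theorem toConj_mul (a b : A) : toConj (a * b) = toConj b * toConj a := rfl
theorem toConj_add (a b : A) : toConj (a + b) = toConj a + toConj b := rfl
theorem toConj_one : toConj (1 : A) = 1 := rfl
theorem toConj_sum {ι : Type} (s : Finset ι) (f : ι → A) :
    toConj (∑ i ∈ s, f i) = ∑ i ∈ s, toConj (f i) :=
  map_sum (MulOpposite.opAddEquiv (α := A)) f s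
theorem ofConj_mul (a b : ConjOp A) : ofConj (a * b) = ofConj b * ofConj a := rfl
theorem ofConj_add (a b : ConjOp A) : ofConj (a + b) = ofConj a + ofConj b := rfl
theorem ofConj_one : ofConj (1 : ConjOp A) = 1 := rfl
theorem ofConj_zero : ofConj (0 : ConjOp A) = 0 := rfl

variable [Algebra ℂ A]

theorem smul_toConj (c : ℂ) (a : A) : c • toConj a = toConj (star c • a) := rfl
theorem ofConj_smul (c : ℂ) (a : ConjOp A) : ofConj (c • a) = star c • ofConj a := rfl

/-- The star structure given by an involutive conjugate-linear antimultiplicative map. -/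
abbrev starRingOfConj (S : A →ₐ[ℂ] ConjOp A) (h : ∀ a, ofConj (S (ofConj (S a))) = a) :
    StarRing A where
  star a := ofConj (S a)
  star_involutive := h
  star_mul a b := by rw [map_mul, ofConj_mul]
  star_add a b := by rw [map_add, ofConj_add]

/-- A map as above that squares to the identity on algebra generators is an involution. -/
theorem ofConj_involutive (S : A →ₐ[ℂ] ConjOp A) {X : Type} (gen : X → A)
    (hgen : ∀ F G : A →ₐ[ℂ] A, (∀ x, F (gen x) = G (gen x)) → F = G)
    (h : ∀ x, ofConj (S (ofConj (S (gen x)))) = gen x) (a : A) :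
    ofConj (S (ofConj (S a))) = a := by
  let T : A →ₐ[ℂ] A :=
    AlgHom.ofLinearMap
      { toFun := fun a => ofConj (S (ofConj (S a)))
        map_add' := fun a b => by simp only [map_add, ofConj_add]
        map_smul' := fun c a => by simp [map_smul, ofConj_smul] }
      (by simp [ofConj_one]) (fun a b => by simp [ofConj_mul])
  have hT : T = AlgHom.id ℂ _ := hgen _ _ h
  exact congrArg (fun F : A →ₐ[ℂ] A => F a) hT

end Conj

/-! ### Noncommutative spheres -/

/-- The deformation parameters `λ^{μν} = exp (2πi Θ_{μν})`. -/
def lam {n : ℕ} (Θ : Matrix (Fin n) (Fin n) ℝ) (μ ν : Fin n) : ℂ :=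
  Complex.exp (2 * Real.pi * Complex.I * (Θ μ ν : ℝ))

theorem star_lam {n : ℕ} {Θ : Matrix (Fin n) (Fin n) ℝ} (h : Θᵀ = -Θ) (μ ν : Fin n) :
    (starRingEnd ℂ) (lam Θ μ ν) = lam Θ ν μ := by
  have h1 : Θ ν μ = - Θ μ ν := congrFun (congrFun h μ) ν
  simp [lam, ← Complex.exp_conj, h1, map_ofNat]

/-- Generators `z^μ`, `z̄^μ` of the noncommutative `2n`-plane. -/
inductive EvenGen (n : ℕ) : Type
  | z (μ : Fin n)
  | zb (μ : Fin n)

/-- Generators `z^μ`, `z̄^μ`, `x` of the noncommutative `(2n+1)`-plane. -/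
inductive OddGen (n : ℕ) : Type
  | z (μ : Fin n)
  | zb (μ : Fin n)
  | x

section OddSphere

variable {n : ℕ} (Θ : Matrix (Fin n) (Fin n) ℝ)

/-- The defining relations of `A(S_Θ^{2n-1})`. -/
inductive OddSphereRel : FreeAlgebra ℂ (EvenGen n) → FreeAlgebra ℂ (EvenGen n) → Prop
  | zz (μ ν : Fin n) : OddSphereRel
      (FreeAlgebra.ι ℂ (.z μ) * FreeAlgebra.ι ℂ (.z ν))
      (lam Θ μ ν • (FreeAlgebra.ι ℂ (.z ν) * FreeAlgebra.ι ℂ (.z μ)))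
  | zbz (μ ν : Fin n) : OddSphereRel
      (FreeAlgebra.ι ℂ (.zb μ) * FreeAlgebra.ι ℂ (.z ν))
      (lam Θ ν μ • (FreeAlgebra.ι ℂ (.z ν) * FreeAlgebra.ι ℂ (.zb μ)))
  | zbzb (μ ν : Fin n) : OddSphereRel
      (FreeAlgebra.ι ℂ (.zb μ) * FreeAlgebra.ι ℂ (.zb ν))
      (lam Θ μ ν • (FreeAlgebra.ι ℂ (.zb ν) * FreeAlgebra.ι ℂ (.zb μ)))
  | sphere : OddSphereRel
      (∑ μ, FreeAlgebra.ι ℂ (.z μ) * FreeAlgebra.ι ℂ (.zb μ)) 1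

/-- The polynomial algebra `A(S_Θ^{2n-1})` of the noncommutative sphere. -/
def OddSphere : Type := RingQuot (OddSphereRel Θ)

instance : Ring (OddSphere Θ) := inferInstanceAs (Ring (RingQuot (OddSphereRel Θ)))

instance : Algebra ℂ (OddSphere Θ) := inferInstanceAs (Algebra ℂ (RingQuot (OddSphereRel Θ)))

namespace OddSphere

/-- The quotient map. -/
def mk : FreeAlgebra ℂ (EvenGen n) →ₐ[ℂ] OddSphere Θ := RingQuot.mkAlgHom ℂ (OddSphereRel Θ)

theorem mk_rel {a b : FreeAlgebra ℂ (EvenGen n)} (h : OddSphereRel Θ a b) : mk Θ a = mk Θ b :=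
  RingQuot.mkAlgHom_rel ℂ h

variable {Θ} in
theorem hom_ext {B : Type} [Ring B] [Algebra ℂ B] {F G : OddSphere Θ →ₐ[ℂ] B}
    (h : ∀ g, F (mk Θ (FreeAlgebra.ι ℂ g)) = G (mk Θ (FreeAlgebra.ι ℂ g))) : F = G :=
  RingQuot.ringQuot_ext' ℂ (s := OddSphereRel Θ) F G (FreeAlgebra.hom_ext (funext h))

/-- The classes of the generators. -/
def gen (g : EvenGen n) : OddSphere Θ := mk Θ (FreeAlgebra.ι ℂ g)

theorem zz (μ ν : Fin n) : gen Θ (.z μ) * gen Θ (.z ν) =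
    lam Θ μ ν • (gen Θ (.z ν) * gen Θ (.z μ)) := by
  simpa [gen] using mk_rel Θ (OddSphereRel.zz (Θ := Θ) μ ν)

theorem zbz (μ ν : Fin n) : gen Θ (.zb μ) * gen Θ (.z ν) =
    lam Θ ν μ • (gen Θ (.z ν) * gen Θ (.zb μ)) := by
  simpa [gen] using mk_rel Θ (OddSphereRel.zbz (Θ := Θ) μ ν)

theorem zbzb (μ ν : Fin n) : gen Θ (.zb μ) * gen Θ (.zb ν) =
    lam Θ μ ν • (gen Θ (.zb ν) * gen Θ (.zb μ)) := by
  simpa [gen] using mk_rel Θ (OddSphereRel.zbzb (Θ := Θ) μ ν)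

theorem sphere : ∑ μ, gen Θ (.z μ) * gen Θ (.zb μ) = 1 := by
  simpa [gen] using mk_rel Θ (OddSphereRel.sphere (Θ := Θ))

variable {Θ}

/-- The universal property of `A(S_Θ^{2n-1})`. -/
def lift {B : Type} [Ring B] [Algebra ℂ B] (f : EvenGen n → B)
    (h1 : ∀ μ ν, f (.z μ) * f (.z ν) = lam Θ μ ν • (f (.z ν) * f (.z μ)))
    (h2 : ∀ μ ν, f (.zb μ) * f (.z ν) = lam Θ ν μ • (f (.z ν) * f (.zb μ)))
    (h3 : ∀ μ ν, f (.zb μ) * f (.zb ν) = lam Θ μ ν • (f (.zb ν) * f (.zb μ)))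
    (h4 : ∑ μ, f (.z μ) * f (.zb μ) = 1) : OddSphere Θ →ₐ[ℂ] B :=
  RingQuot.liftAlgHom ℂ (s := OddSphereRel Θ) ⟨FreeAlgebra.lift ℂ f, by
    intro a b h
    cases h with
    | zz μ ν => simpa using h1 μ ν
    | zbz μ ν => simpa using h2 μ ν
    | zbzb μ ν => simpa using h3 μ ν
    | sphere => simpa using h4⟩

theorem lift_gen {B : Type} [Ring B] [Algebra ℂ B] (f : EvenGen n → B) (h1 h2 h3 h4)
    (g : EvenGen n) : lift (Θ := Θ) f h1 h2 h3 h4 (gen Θ g) = f g :=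
  (RingQuot.liftAlgHom_mkAlgHom_apply ℂ (FreeAlgebra.lift ℂ f) (s := OddSphereRel Θ) _ _).trans
    (FreeAlgebra.lift_ι_apply f g)

/-- The involution `z^μ ↦ z̄^μ`, `z̄^μ ↦ z^μ`, as a map to the conjugate opposite algebra. -/
def conj (h : Θᵀ = -Θ) : OddSphere Θ →ₐ[ℂ] ConjOp (OddSphere Θ) :=
  lift (fun g => match g with
      | .z μ => toConj (gen Θ (.zb μ))
      | .zb μ => toConj (gen Θ (.z μ)))
    (fun μ ν => by
      simp only [← toConj_mul, smul_toConj]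
      rw [zbzb]; simp [star_lam h])
    (fun μ ν => by
      simp only [← toConj_mul, smul_toConj]
      rw [zbz]; simp [star_lam h])
    (fun μ ν => by
      simp only [← toConj_mul, smul_toConj]
      rw [zz]; simp [star_lam h])
    (by
      simp only [← toConj_mul, ← toConj_sum]
      rw [sphere, toConj_one])

instance instStarRing [h : Fact (Θᵀ = -Θ)] : StarRing (OddSphere Θ) :=
  starRingOfConj (conj h.out) (ofConj_involutive _ (gen Θ) (fun _ _ => hom_ext) (by
    intro g
    cases g <;> simp [conj, lift_gen]))

instance [h : Fact (Θᵀ = -Θ)] : StarModule ℂ (OddSphere Θ) :=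
  ⟨fun c a => by
    change ofConj (conj h.out (c • a)) = star c • ofConj (conj h.out a)
    rw [map_smul, ofConj_smul]⟩

theorem star_z [h : Fact (Θᵀ = -Θ)] (μ : Fin n) : star (gen Θ (.z μ)) = gen Θ (.zb μ) := by
  change ofConj (conj h.out (gen Θ (.z μ))) = _
  simp [conj, lift_gen]

theorem star_zb [h : Fact (Θᵀ = -Θ)] (μ : Fin n) : star (gen Θ (.zb μ)) = gen Θ (.z μ) := by
  rw [← star_z, star_star]

end OddSphere

end OddSphere

section EvenSphere

variable {n : ℕ} (Θ : Matrix (Fin n) (Fin n) ℝ)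

/-- The defining relations of `A(S_Θ^{2n})`. -/
inductive EvenSphereRel : FreeAlgebra ℂ (OddGen n) → FreeAlgebra ℂ (OddGen n) → Prop
  | zz (μ ν : Fin n) : EvenSphereRel
      (FreeAlgebra.ι ℂ (.z μ) * FreeAlgebra.ι ℂ (.z ν))
      (lam Θ μ ν • (FreeAlgebra.ι ℂ (.z ν) * FreeAlgebra.ι ℂ (.z μ)))
  | zbz (μ ν : Fin n) : EvenSphereRel
      (FreeAlgebra.ι ℂ (.zb μ) * FreeAlgebra.ι ℂ (.z ν))
      (lam Θ ν μ • (FreeAlgebra.ι ℂ (.z ν) * FreeAlgebra.ι ℂ (.zb μ)))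
  | zbzb (μ ν : Fin n) : EvenSphereRel
      (FreeAlgebra.ι ℂ (.zb μ) * FreeAlgebra.ι ℂ (.zb ν))
      (lam Θ μ ν • (FreeAlgebra.ι ℂ (.zb ν) * FreeAlgebra.ι ℂ (.zb μ)))
  | xz (μ : Fin n) : EvenSphereRel
      (FreeAlgebra.ι ℂ .x * FreeAlgebra.ι ℂ (.z μ))
      (FreeAlgebra.ι ℂ (.z μ) * FreeAlgebra.ι ℂ .x)
  | xzb (μ : Fin n) : EvenSphereRel
      (FreeAlgebra.ι ℂ .x * FreeAlgebra.ι ℂ (.zb μ))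
      (FreeAlgebra.ι ℂ (.zb μ) * FreeAlgebra.ι ℂ .x)
  | sphere : EvenSphereRel
      (∑ μ, FreeAlgebra.ι ℂ (.z μ) * FreeAlgebra.ι ℂ (.zb μ) +
        FreeAlgebra.ι ℂ .x * FreeAlgebra.ι ℂ .x) 1

/-- The polynomial algebra `A(S_Θ^{2n})` of the noncommutative sphere. -/
def EvenSphere : Type := RingQuot (EvenSphereRel Θ)

instance : Ring (EvenSphere Θ) := inferInstanceAs (Ring (RingQuot (EvenSphereRel Θ)))

instance : Algebra ℂ (EvenSphere Θ) := inferInstanceAs (Algebra ℂ (RingQuot (EvenSphereRel Θ)))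

namespace EvenSphere

/-- The quotient map. -/
def mk : FreeAlgebra ℂ (OddGen n) →ₐ[ℂ] EvenSphere Θ := RingQuot.mkAlgHom ℂ (EvenSphereRel Θ)

theorem mk_rel {a b : FreeAlgebra ℂ (OddGen n)} (h : EvenSphereRel Θ a b) : mk Θ a = mk Θ b :=
  RingQuot.mkAlgHom_rel ℂ h

variable {Θ} in
theorem hom_ext {B : Type} [Ring B] [Algebra ℂ B] {F G : EvenSphere Θ →ₐ[ℂ] B}
    (h : ∀ g, F (mk Θ (FreeAlgebra.ι ℂ g)) = G (mk Θ (FreeAlgebra.ι ℂ g))) : F = G :=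
  RingQuot.ringQuot_ext' ℂ (s := EvenSphereRel Θ) F G (FreeAlgebra.hom_ext (funext h))

/-- The classes of the generators. -/
def gen (g : OddGen n) : EvenSphere Θ := mk Θ (FreeAlgebra.ι ℂ g)

theorem zz (μ ν : Fin n) : gen Θ (.z μ) * gen Θ (.z ν) =
    lam Θ μ ν • (gen Θ (.z ν) * gen Θ (.z μ)) := by
  simpa [gen] using mk_rel Θ (EvenSphereRel.zz (Θ := Θ) μ ν)

theorem zbz (μ ν : Fin n) : gen Θ (.zb μ) * gen Θ (.z ν) =
    lam Θ ν μ • (gen Θ (.z ν) * gen Θ (.zb μ)) := by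
  simpa [gen] using mk_rel Θ (EvenSphereRel.zbz (Θ := Θ) μ ν)

theorem zbzb (μ ν : Fin n) : gen Θ (.zb μ) * gen Θ (.zb ν) =
    lam Θ μ ν • (gen Θ (.zb ν) * gen Θ (.zb μ)) := by
  simpa [gen] using mk_rel Θ (EvenSphereRel.zbzb (Θ := Θ) μ ν)

theorem xz (μ : Fin n) : gen Θ .x * gen Θ (.z μ) = gen Θ (.z μ) * gen Θ .x := by
  simpa [gen] using mk_rel Θ (EvenSphereRel.xz (Θ := Θ) μ)

theorem xzb (μ : Fin n) : gen Θ .x * gen Θ (.zb μ) = gen Θ (.zb μ) * gen Θ .x := by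
  simpa [gen] using mk_rel Θ (EvenSphereRel.xzb (Θ := Θ) μ)

theorem sphere : ∑ μ, gen Θ (.z μ) * gen Θ (.zb μ) + gen Θ .x * gen Θ .x = 1 := by
  simpa [gen] using mk_rel Θ (EvenSphereRel.sphere (Θ := Θ))

variable {Θ}

/-- The universal property of `A(S_Θ^{2n})`. -/
def lift {B : Type} [Ring B] [Algebra ℂ B] (f : OddGen n → B)
    (h1 : ∀ μ ν, f (.z μ) * f (.z ν) = lam Θ μ ν • (f (.z ν) * f (.z μ)))
    (h2 : ∀ μ ν, f (.zb μ) * f (.z ν) = lam Θ ν μ • (f (.z ν) * f (.zb μ)))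
    (h3 : ∀ μ ν, f (.zb μ) * f (.zb ν) = lam Θ μ ν • (f (.zb ν) * f (.zb μ)))
    (h4 : ∀ μ, f .x * f (.z μ) = f (.z μ) * f .x)
    (h5 : ∀ μ, f .x * f (.zb μ) = f (.zb μ) * f .x)
    (h6 : ∑ μ, f (.z μ) * f (.zb μ) + f .x * f .x = 1) : EvenSphere Θ →ₐ[ℂ] B :=
  RingQuot.liftAlgHom ℂ (s := EvenSphereRel Θ) ⟨FreeAlgebra.lift ℂ f, by
    intro a b h
    cases h with
    | zz μ ν => simpa using h1 μ ν
    | zbz μ ν => simpa using h2 μ ν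
    | zbzb μ ν => simpa using h3 μ ν
    | xz μ => simpa using h4 μ
    | xzb μ => simpa using h5 μ
    | sphere => simpa using h6⟩

theorem lift_gen {B : Type} [Ring B] [Algebra ℂ B] (f : OddGen n → B) (h1 h2 h3 h4 h5 h6)
    (g : OddGen n) : lift (Θ := Θ) f h1 h2 h3 h4 h5 h6 (gen Θ g) = f g :=
  (RingQuot.liftAlgHom_mkAlgHom_apply ℂ (FreeAlgebra.lift ℂ f) (s := EvenSphereRel Θ) _ _).trans
    (FreeAlgebra.lift_ι_apply f g)

/-- The involution `z^μ ↦ z̄^μ`, `z̄^μ ↦ z^μ`, `x ↦ x`, as a map to the conjugate opposite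
algebra. -/
def conj (h : Θᵀ = -Θ) : EvenSphere Θ →ₐ[ℂ] ConjOp (EvenSphere Θ) :=
  lift (fun g => match g with
      | .z μ => toConj (gen Θ (.zb μ))
      | .zb μ => toConj (gen Θ (.z μ))
      | .x => toConj (gen Θ .x))
    (fun μ ν => by
      simp only [← toConj_mul, smul_toConj]
      rw [zbzb]; simp [star_lam h])
    (fun μ ν => by
      simp only [← toConj_mul, smul_toConj]
      rw [zbz]; simp [star_lam h])
    (fun μ ν => by
      simp only [← toConj_mul, smul_toConj]
      rw [zz]; simp [star_lam h])
    (fun μ => by simp only [← toConj_mul]; rw [xzb])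
    (fun μ => by simp only [← toConj_mul]; rw [xz])
    (by
      simp only [← toConj_mul, ← toConj_sum, ← toConj_add]
      rw [sphere, toConj_one])

instance instStarRing [h : Fact (Θᵀ = -Θ)] : StarRing (EvenSphere Θ) :=
  starRingOfConj (conj h.out) (ofConj_involutive _ (gen Θ) (fun _ _ => hom_ext) (by
    intro g
    cases g <;> simp [conj, lift_gen]))

instance [h : Fact (Θᵀ = -Θ)] : StarModule ℂ (EvenSphere Θ) :=
  ⟨fun c a => by
    change ofConj (conj h.out (c • a)) = star c • ofConj (conj h.out a)
    rw [map_smul, ofConj_smul]⟩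

end EvenSphere

end EvenSphere

/-! ### The spheres `S_θ^4` and `S_θ'^7` -/

/-- The deformation matrix of `S_θ^4`. -/
def theta4 (θ : ℝ) : Matrix (Fin 2) (Fin 2) ℝ := !![0, θ; -θ, 0]

/-- The deformation matrix `θ'` of `S_θ'^7`. -/
def theta7 (θ : ℝ) : Matrix (Fin 4) (Fin 4) ℝ :=
  (θ / 2) • !![0, 0, 1, 1; 0, 0, 1, 1; -1, -1, 0, 0; -1, -1, 0, 0]

instance (θ : ℝ) : Fact ((theta4 θ)ᵀ = -theta4 θ) :=
  ⟨by ext i j; fin_cases i <;> fin_cases j <;> simp [theta4]⟩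

instance (θ : ℝ) : Fact ((theta7 θ)ᵀ = -theta7 θ) :=
  ⟨by ext i j; fin_cases i <;> fin_cases j <;> simp [theta7]⟩

/-- The algebra `A(S_θ^4)`. -/
abbrev A4 (θ : ℝ) : Type := EvenSphere (theta4 θ)

/-- The algebra `A(S_θ'^7)`. -/
abbrev A7 (θ : ℝ) : Type := OddSphere (theta7 θ)

/-- The generators `z^1, …, z^4` of `A(S_θ'^7)` (indexed from `0`). -/
def z (θ : ℝ) (μ : Fin 4) : A7 θ := OddSphere.gen (theta7 θ) (.z μ)

/-- The generators `z̄^1, …, z̄^4` of `A(S_θ'^7)` (indexed from `0`). -/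
def zb (θ : ℝ) (μ : Fin 4) : A7 θ := OddSphere.gen (theta7 θ) (.zb μ)

/-! ### The action of `SU(2)` on `A(S_θ'^7)` -/

/-- The group `SU(2)`. -/
abbrev SU2 : Type := Matrix.specialUnitaryGroup (Fin 2) ℂ

/-- The block matrix `diag(w, w)`. -/
def blockMatrix (w : SU2) : Matrix (Fin 4) (Fin 4) ℂ :=
  !![w.1 0 0, w.1 0 1, 0, 0;
     w.1 1 0, w.1 1 1, 0, 0;
     0, 0, w.1 0 0, w.1 0 1;
     0, 0, w.1 1 0, w.1 1 1]

/-- The images `(z^1, …, z^4) diag(w, w)` of the generators, and their adjoints. -/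
def actionGen (θ : ℝ) (w : SU2) : EvenGen 4 → A7 θ
  | .z μ => ∑ ν, blockMatrix w ν μ • z θ ν
  | .zb μ => ∑ ν, star (blockMatrix w ν μ) • zb θ ν

theorem blockMatrix_lam (θ : ℝ) (w : SU2) (ρ μ σ ν : Fin 4) :
    blockMatrix w ρ μ = 0 ∨ blockMatrix w σ ν = 0 ∨
      lam (theta7 θ) ρ σ = lam (theta7 θ) μ ν := by
  fin_cases ρ <;> fin_cases μ <;> first
    | (left; rfl)
    | (right
       fin_cases σ <;> fin_cases ν <;> first
        | (left; rfl)
        | (right; simp [lam, theta7]))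

theorem sum_smul_comm {B : Type} [Ring B] [Algebra ℂ B] {a b : Fin 4 → ℂ} {f g : Fin 4 → B}
    {c : ℂ} (h : ∀ ρ σ, a ρ = 0 ∨ b σ = 0 ∨ f ρ * g σ = c • (g σ * f ρ)) :
    (∑ ρ, a ρ • f ρ) * (∑ σ, b σ • g σ) = c • ((∑ σ, b σ • g σ) * (∑ ρ, a ρ • f ρ)) := by
  rw [Finset.sum_mul_sum, Finset.sum_mul_sum, Finset.sum_comm, Finset.smul_sum]
  refine Finset.sum_congr rfl fun σ _ => ?_
  rw [Finset.smul_sum]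
  refine Finset.sum_congr rfl fun ρ _ => ?_
  rcases h ρ σ with h | h | h
  · simp [h]
  · simp [h]
  · simp only [smul_mul_smul_comm, h, smul_smul]
    congr 1
    ring

theorem blockMatrix_mul_star (w : SU2) : blockMatrix w * (blockMatrix w)ᴴ = 1 := by
  have h := (Matrix.mem_specialUnitaryGroup_iff.1 w.2).1
  have h1 : w.1 * star w.1 = 1 := Matrix.mem_unitaryGroup_iff.1 h
  have e := fun i j => congrFun (congrFun h1 i) j
  simp only [Matrix.mul_apply, Fin.sum_univ_two, Matrix.star_apply] at e
  have e00 := e 0 0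
  have e01 := e 0 1
  have e10 := e 1 0
  have e11 := e 1 1
  simp only [Matrix.one_apply_eq, Matrix.one_apply_ne (Fin.zero_ne_one),
    Matrix.one_apply_ne (Fin.zero_ne_one.symm)] at e00 e01 e10 e11
  ext i j
  fin_cases i <;> fin_cases j <;>
    simp [blockMatrix, Matrix.mul_apply, Fin.sum_univ_four] <;> assumption

/-- The automorphism `α_w` of `A(S_θ'^7)`:
`(z^1, z^2, z^3, z^4) ↦ (z^1, z^2, z^3, z^4) diag(w, w)`. -/
def action (θ : ℝ) (w : SU2) : A7 θ →ₐ[ℂ] A7 θ :=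
  OddSphere.lift (actionGen θ w)
    (fun μ ν => sum_smul_comm fun ρ σ => by
      rcases blockMatrix_lam θ w ρ μ σ ν with h | h | h
      · exact Or.inl h
      · exact Or.inr (Or.inl h)
      · exact Or.inr (Or.inr (h ▸ OddSphere.zz _ ρ σ)))
    (fun μ ν => sum_smul_comm fun ρ σ => by
      rcases blockMatrix_lam θ w σ ν ρ μ with h | h | h
      · exact Or.inr (Or.inl h)
      · exact Or.inl (by rw [h, star_zero])
      · exact Or.inr (Or.inr (h ▸ OddSphere.zbz _ ρ σ)))
    (fun μ ν => sum_smul_comm fun ρ σ => by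
      rcases blockMatrix_lam θ w ρ μ σ ν with h | h | h
      · exact Or.inl (by rw [h, star_zero])
      · exact Or.inr (Or.inl (by rw [h, star_zero]))
      · exact Or.inr (Or.inr (h ▸ OddSphere.zbzb _ ρ σ)))
    (by
      have h := blockMatrix_mul_star w
      have e := fun i j => congrFun (congrFun h i) j
      simp only [Matrix.mul_apply, Matrix.conjTranspose_apply] at e
      simp only [actionGen, Finset.sum_mul_sum, smul_mul_smul_comm]
      rw [Finset.sum_comm]
      rw [← OddSphere.sphere]
      refine Finset.sum_congr rfl fun ρ _ => ?_
      rw [Finset.sum_comm]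
      simp only [← Finset.sum_smul, e, Matrix.one_apply, ite_smul, one_smul, zero_smul,
        Finset.sum_ite_eq, Finset.mem_univ, if_true]
      rfl)

theorem action_z (θ : ℝ) (w : SU2) (μ : Fin 4) :
    action θ w (z θ μ) = ∑ ν, blockMatrix w ν μ • z θ ν := OddSphere.lift_gen _ _ _ _ _ _

theorem action_zb (θ : ℝ) (w : SU2) (μ : Fin 4) :
    action θ w (zb θ μ) = ∑ ν, star (blockMatrix w ν μ) • zb θ ν :=
  OddSphere.lift_gen _ _ _ _ _ _

theorem star_z (θ : ℝ) (μ : Fin 4) : star (z θ μ) = zb θ μ := OddSphere.star_z μ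

theorem star_zb (θ : ℝ) (μ : Fin 4) : star (zb θ μ) = z θ μ := OddSphere.star_zb μ

/-! ### The inclusion of `A(S_θ^4)` in `A(S_θ'^7)` -/

/-- The element `α = 2 (z^1 z̄^3 + z^2 z̄^4)`. -/
def alpha (θ : ℝ) : A7 θ := 2 * (z θ 0 * zb θ 2 + z θ 1 * zb θ 3)

/-- The element `β = 2 (- z^1 z^4 + z^2 z^3)`. -/
def beta (θ : ℝ) : A7 θ := 2 * (-(z θ 0 * z θ 3) + z θ 1 * z θ 2)

/-- The element `x = z^1 z̄^1 + z^2 z̄^2 - z^3 z̄^3 - z^4 z̄^4`. -/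
def xx (θ : ℝ) : A7 θ :=
  z θ 0 * zb θ 0 + z θ 1 * zb θ 1 - z θ 2 * zb θ 2 - z θ 3 * zb θ 3

theorem star_alpha (θ : ℝ) : star (alpha θ) = 2 * (z θ 2 * zb θ 0 + z θ 3 * zb θ 1) := by
  rw [alpha, two_mul, two_mul]
  simp only [star_add, star_mul, star_z, star_zb]

theorem star_beta (θ : ℝ) :
    star (beta θ) = 2 * (-(zb θ 3 * zb θ 0) + zb θ 2 * zb θ 1) := by
  rw [beta, two_mul, two_mul]
  simp only [star_add, star_neg, star_mul, star_z]

/-- The bidegree of a generator of `A(S_θ'^7)` for the torus action. -/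
def genDegree : EvenGen 4 → ℤ × ℤ
  | .z μ => ![(1, 0), (1, 0), (0, 1), (0, 1)] μ
  | .zb μ => ![(-1, 0), (-1, 0), (0, -1), (0, -1)] μ

/-- The commutation factor of elements of bidegrees `d` and `e`. -/
def factor (θ : ℝ) (d e : ℤ × ℤ) : ℂ :=
  Complex.exp (2 * Real.pi * Complex.I * ((θ / 2 * (d.1 * e.2 - d.2 * e.1) : ℝ) : ℂ))

/-- Elements of `A(S_θ'^7)` that are visibly homogeneous. -/
inductive HasDegree (θ : ℝ) : ℤ × ℤ → A7 θ → Prop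
  | gen (g : EvenGen 4) : HasDegree θ (genDegree g) (OddSphere.gen _ g)
  | two : HasDegree θ 0 2
  | add {d a b} : HasDegree θ d a → HasDegree θ d b → HasDegree θ d (a + b)
  | neg {d a} : HasDegree θ d a → HasDegree θ d (-a)
  | mul {d e a b} : HasDegree θ d a → HasDegree θ e b → HasDegree θ (d + e) (a * b)

theorem factor_add_left (θ : ℝ) (d d' e : ℤ × ℤ) :
    factor θ (d + d') e = factor θ d e * factor θ d' e := by
  rw [factor, factor, factor, ← Complex.exp_add]
  congr 1
  push_cast [Prod.fst_add, Prod.snd_add]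
  ring

theorem factor_add_right (θ : ℝ) (d e e' : ℤ × ℤ) :
    factor θ d (e + e') = factor θ d e * factor θ d e' := by
  rw [factor, factor, factor, ← Complex.exp_add]
  congr 1
  push_cast [Prod.fst_add, Prod.snd_add]
  ring

theorem factor_zero_left (θ : ℝ) (e : ℤ × ℤ) : factor θ 0 e = 1 := by simp [factor]

theorem factor_zero_right (θ : ℝ) (d : ℤ × ℤ) : factor θ d 0 = 1 := by simp [factor]

theorem smul_eq_inv {B : Type} [Ring B] [Algebra ℂ B] {a b : B} {c d : ℂ} (h : a = c • b)
    (hd : d * c = 1) : b = d • a := by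
  rw [h, smul_smul, hd, one_smul]

theorem gen_comm (θ : ℝ) (g h : EvenGen 4) :
    OddSphere.gen (theta7 θ) g * OddSphere.gen (theta7 θ) h =
      factor θ (genDegree g) (genDegree h) •
        (OddSphere.gen (theta7 θ) h * OddSphere.gen (theta7 θ) g) := by
  cases g with
  | z μ =>
    cases h with
    | z ν =>
      have e : factor θ (genDegree (.z μ)) (genDegree (.z ν)) = lam (theta7 θ) μ ν := by
        fin_cases μ <;> fin_cases ν <;> simp [factor, genDegree, lam, theta7]
      rw [e]; exact OddSphere.zz _ μ ν
    | zb ν =>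
      refine smul_eq_inv (OddSphere.zbz _ ν μ) ?_
      rw [factor, lam, ← Complex.exp_add, ← Complex.exp_zero]
      congr 1
      fin_cases μ <;> fin_cases ν <;> simp [genDegree, theta7]
  | zb μ =>
    cases h with
    | z ν =>
      have e : factor θ (genDegree (.zb μ)) (genDegree (.z ν)) = lam (theta7 θ) ν μ := by
        fin_cases μ <;> fin_cases ν <;> simp [factor, genDegree, lam, theta7]
      rw [e]; exact OddSphere.zbz _ μ ν
    | zb ν =>
      have e : factor θ (genDegree (.zb μ)) (genDegree (.zb ν)) = lam (theta7 θ) μ ν := by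
        fin_cases μ <;> fin_cases ν <;> simp [factor, genDegree, lam, theta7]
      rw [e]; exact OddSphere.zbzb _ μ ν

theorem HasDegree.comm {θ : ℝ} {d e : ℤ × ℤ} {a b : A7 θ} (ha : HasDegree θ d a)
    (hb : HasDegree θ e b) : a * b = factor θ d e • (b * a) := by
  induction ha with
  | gen g =>
    induction hb with
    | gen h => exact gen_comm θ g h
    | two => rw [factor_zero_right, one_smul, mul_two, two_mul]
    | add _ _ h1 h2 => rw [mul_add, add_mul, smul_add, h1, h2]
    | neg _ h1 => rw [mul_neg, neg_mul, smul_neg, h1]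
    | mul _ _ h1 h2 =>
      rw [← mul_assoc, h1, smul_mul_assoc, mul_assoc, h2, mul_smul_comm, smul_smul,
        factor_add_right, mul_assoc]
  | two => rw [factor_zero_left, one_smul, mul_two, two_mul]
  | add _ _ h1 h2 => rw [mul_add, add_mul, smul_add, h1, h2]
  | neg _ h1 => rw [mul_neg, neg_mul, smul_neg, h1]
  | mul _ _ h1 h2 =>
    rw [mul_assoc, h2, mul_smul_comm, ← mul_assoc, h1, smul_mul_assoc, smul_smul,
      factor_add_left, mul_assoc, mul_comm (factor _ _ _)]

theorem hasDegree_z (θ : ℝ) (μ : Fin 4) : HasDegree θ (genDegree (.z μ)) (z θ μ) :=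
  HasDegree.gen _

theorem hasDegree_zb (θ : ℝ) (μ : Fin 4) : HasDegree θ (genDegree (.zb μ)) (zb θ μ) :=
  HasDegree.gen _

theorem hasDegree_alpha (θ : ℝ) : HasDegree θ (1, -1) (alpha θ) :=
  HasDegree.mul (d := 0) .two (.add (.mul (hasDegree_z θ 0) (hasDegree_zb θ 2))
    (.mul (hasDegree_z θ 1) (hasDegree_zb θ 3)))

theorem hasDegree_star_alpha (θ : ℝ) : HasDegree θ (-1, 1) (star (alpha θ)) := by
  rw [star_alpha]
  exact HasDegree.mul (d := 0) .two (.add (.mul (hasDegree_z θ 2) (hasDegree_zb θ 0))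
    (.mul (hasDegree_z θ 3) (hasDegree_zb θ 1)))

theorem hasDegree_beta (θ : ℝ) : HasDegree θ (1, 1) (beta θ) :=
  HasDegree.mul (d := 0) .two (.add (.neg (.mul (hasDegree_z θ 0) (hasDegree_z θ 3)))
    (.mul (hasDegree_z θ 1) (hasDegree_z θ 2)))

theorem hasDegree_star_beta (θ : ℝ) : HasDegree θ (-1, -1) (star (beta θ)) := by
  rw [star_beta]
  exact HasDegree.mul (d := 0) .two (.add (.neg (.mul (hasDegree_zb θ 3) (hasDegree_zb θ 0)))
    (.mul (hasDegree_zb θ 2) (hasDegree_zb θ 1)))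

theorem hasDegree_xx (θ : ℝ) : HasDegree θ 0 (xx θ) := by
  rw [xx, sub_eq_add_neg, sub_eq_add_neg]
  exact .add (.add (.add (.mul (hasDegree_z θ 0) (hasDegree_zb θ 0))
    (.mul (hasDegree_z θ 1) (hasDegree_zb θ 1)))
    (.neg (.mul (hasDegree_z θ 2) (hasDegree_zb θ 2))))
    (.neg (.mul (hasDegree_z θ 3) (hasDegree_zb θ 3)))

theorem HasDegree.comm_zero {θ : ℝ} {e : ℤ × ℤ} {a b : A7 θ} (ha : HasDegree θ 0 a)
    (hb : HasDegree θ e b) : a * b = b * a := by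
  rw [ha.comm hb, factor_zero_left, one_smul]

theorem swap4 {θ : ℝ} {e : ℤ × ℤ} (a : A7 θ) {b c d : A7 θ} (hbc : HasDegree θ 0 (b * c))
    (hd : HasDegree θ e d) : a * b * (c * d) = a * d * (b * c) := by
  rw [mul_assoc, ← mul_assoc b, hbc.comm_zero hd, mul_assoc]

theorem sphere4 (θ : ℝ) :
    alpha θ * star (alpha θ) + beta θ * star (beta θ) + xx θ * xx θ = 1 := by
  rw [star_alpha, star_beta, alpha, beta, xx]
  have hs := OddSphere.sphere (theta7 θ)
  rw [Fin.sum_univ_four] at hs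
  change z θ 0 * zb θ 0 + z θ 1 * zb θ 1 + z θ 2 * zb θ 2 + z θ 3 * zb θ 3 = 1 at hs
  have hz := hasDegree_z θ
  have hb := hasDegree_zb θ
  have bz : ∀ i j : Fin 4, factor θ (genDegree (.zb i)) (genDegree (.z j)) = 1 →
      zb θ i * z θ j = z θ j * zb θ i := fun i j h => by
    rw [(hb i).comm (hz j), h, one_smul]
  have e1 : z θ 0 * zb θ 2 * (z θ 2 * zb θ 0) = z θ 0 * zb θ 0 * (z θ 2 * zb θ 2) := by
    rw [swap4 _ ((hb 2).mul (hz 2)) (hb 0), bz 2 2 (by simp [factor, genDegree])]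
  have e2 : z θ 0 * zb θ 2 * (z θ 3 * zb θ 1) = z θ 0 * zb θ 1 * (z θ 3 * zb θ 2) := by
    rw [swap4 _ ((hb 2).mul (hz 3)) (hb 1), bz 2 3 (by simp [factor, genDegree])]
  have e3 : z θ 1 * zb θ 3 * (z θ 2 * zb θ 0) = z θ 1 * zb θ 0 * (z θ 2 * zb θ 3) := by
    rw [swap4 _ ((hb 3).mul (hz 2)) (hb 0), bz 3 2 (by simp [factor, genDegree])]
  have e4 : z θ 1 * zb θ 3 * (z θ 3 * zb θ 1) = z θ 1 * zb θ 1 * (z θ 3 * zb θ 3) := by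
    rw [swap4 _ ((hb 3).mul (hz 3)) (hb 1), bz 3 3 (by simp [factor, genDegree])]
  have f1 : z θ 0 * z θ 3 * (zb θ 3 * zb θ 0) = z θ 0 * zb θ 0 * (z θ 3 * zb θ 3) :=
    swap4 _ ((hz 3).mul (hb 3)) (hb 0)
  have f2 : z θ 0 * z θ 3 * (zb θ 2 * zb θ 1) = z θ 0 * zb θ 1 * (z θ 3 * zb θ 2) :=
    swap4 _ ((hz 3).mul (hb 2)) (hb 1)
  have f3 : z θ 1 * z θ 2 * (zb θ 3 * zb θ 0) = z θ 1 * zb θ 0 * (z θ 2 * zb θ 3) :=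
    swap4 _ ((hz 2).mul (hb 3)) (hb 0)
  have f4 : z θ 1 * z θ 2 * (zb θ 2 * zb θ 1) = z θ 1 * zb θ 1 * (z θ 2 * zb θ 2) :=
    swap4 _ ((hz 2).mul (hb 2)) (hb 1)
  have g1 : 2 * (z θ 0 * zb θ 2 + z θ 1 * zb θ 3) * (2 * (z θ 2 * zb θ 0 + z θ 3 * zb θ 1)) =
      4 * (z θ 0 * zb θ 2 * (z θ 2 * zb θ 0) + z θ 0 * zb θ 2 * (z θ 3 * zb θ 1) +
        z θ 1 * zb θ 3 * (z θ 2 * zb θ 0) + z θ 1 * zb θ 3 * (z θ 3 * zb θ 1)) := by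
    noncomm_ring
  have g2 : 2 * (-(z θ 0 * z θ 3) + z θ 1 * z θ 2) *
        (2 * (-(zb θ 3 * zb θ 0) + zb θ 2 * zb θ 1)) =
      4 * (z θ 0 * z θ 3 * (zb θ 3 * zb θ 0) - z θ 0 * z θ 3 * (zb θ 2 * zb θ 1) -
        z θ 1 * z θ 2 * (zb θ 3 * zb θ 0) + z θ 1 * z θ 2 * (zb θ 2 * zb θ 1)) := by
    noncomm_ring
  rw [g1, g2, e1, e2, e3, e4, f1, f2, f3, f4]
  generalize z θ 0 * zb θ 1 * (z θ 3 * zb θ 2) = t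
  generalize z θ 1 * zb θ 0 * (z θ 2 * zb θ 3) = u
  have hs' : z θ 3 * zb θ 3 = 1 - (z θ 0 * zb θ 0 + z θ 1 * zb θ 1 + z θ 2 * zb θ 2) := by
    rw [← hs]; abel
  rw [hs']
  generalize z θ 0 * zb θ 0 = p
  generalize z θ 1 * zb θ 1 = q
  generalize z θ 2 * zb θ 2 = r
  noncomm_ring

/-- The images in `A(S_θ'^7)` of the generators of `A(S_θ^4)`. -/
def hopfGen (θ : ℝ) : OddGen 2 → A7 θ
  | .z μ => ![alpha θ, beta θ] μ
  | .zb μ => ![star (alpha θ), star (beta θ)] μ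
  | .x => xx θ

/-- The inclusion `A(S_θ^4) → A(S_θ'^7)` sending the generators `α`, `β`, `x` of `A(S_θ^4)` to
the elements `2 (z^1 z̄^3 + z^2 z̄^4)`, `2 (- z^1 z^4 + z^2 z^3)`,
`z^1 z̄^1 + z^2 z̄^2 - z^3 z̄^3 - z^4 z̄^4`, and `α^*`, `β^*` to their adjoints. -/
def hopf (θ : ℝ) : A4 θ →ₐ[ℂ] A7 θ :=
  EvenSphere.lift (hopfGen θ)
    (by
      intro μ ν
      fin_cases μ <;> fin_cases ν
      · simp [hopfGen, lam, theta4]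
      · refine ((hasDegree_alpha θ).comm (hasDegree_beta θ)).trans ?_
        congr 1
        simp [factor, lam, theta4]; ring_nf
      · refine ((hasDegree_beta θ).comm (hasDegree_alpha θ)).trans ?_
        congr 1
        simp [factor, lam, theta4]; ring_nf
      · simp [hopfGen, lam, theta4])
    (by
      intro μ ν
      fin_cases μ <;> fin_cases ν
      · refine ((hasDegree_star_alpha θ).comm (hasDegree_alpha θ)).trans ?_
        congr 1
        simp [factor, lam, theta4]
      · refine ((hasDegree_star_alpha θ).comm (hasDegree_beta θ)).trans ?_
        congr 1
        simp [factor, lam, theta4]; ring_nf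
      · refine ((hasDegree_star_beta θ).comm (hasDegree_alpha θ)).trans ?_
        congr 1
        simp [factor, lam, theta4]; ring_nf
      · refine ((hasDegree_star_beta θ).comm (hasDegree_beta θ)).trans ?_
        congr 1
        simp [factor, lam, theta4])
    (by
      intro μ ν
      fin_cases μ <;> fin_cases ν
      · simp [hopfGen, lam, theta4]
      · refine ((hasDegree_star_alpha θ).comm (hasDegree_star_beta θ)).trans ?_
        congr 1
        simp [factor, lam, theta4]; ring_nf
      · refine ((hasDegree_star_beta θ).comm (hasDegree_star_alpha θ)).trans ?_
        congr 1
        simp [factor, lam, theta4]; ring_nf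
      · simp [hopfGen, lam, theta4])
    (by
      intro μ
      fin_cases μ
      · exact (hasDegree_xx θ).comm_zero (hasDegree_alpha θ)
      · exact (hasDegree_xx θ).comm_zero (hasDegree_beta θ))
    (by
      intro μ
      fin_cases μ
      · exact (hasDegree_xx θ).comm_zero (hasDegree_star_alpha θ)
      · exact (hasDegree_xx θ).comm_zero (hasDegree_star_beta θ))
    (by
      rw [Fin.sum_univ_two]
      exact sphere4 θ)

theorem action_star (θ : ℝ) (w : SU2) (a : A7 θ) : action θ w (star a) = star (action θ w a) := by
  let C : A7 θ →ₐ[ℂ] ConjOp (A7 θ) := OddSphere.conj (Fact.out)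
  have hC : ∀ a, C a = toConj (star a) := fun _ => rfl
  let F : A7 θ →ₐ[ℂ] A7 θ :=
    AlgHom.ofLinearMap
      { toFun := fun a => star (action θ w (star a))
        map_add' := fun a b => by simp
        map_smul' := fun c a => by simp }
      (by simp) (fun a b => by simp)
  have hF : F = action θ w := by
    apply OddSphere.hom_ext
    intro g
    cases g with
    | z μ =>
      change star (action θ w (star (z θ μ))) = action θ w (z θ μ)
      rw [star_z, action_zb, action_z, star_sum]
      exact Finset.sum_congr rfl fun ν _ => by rw [star_smul, star_star, star_zb]
    | zb μ =>
      change star (action θ w (star (zb θ μ))) = action θ w (zb θ μ)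
      rw [star_zb, action_zb, action_z, star_sum]
      exact Finset.sum_congr rfl fun ν _ => by rw [star_smul, star_z]
  have h := congrArg (fun G : A7 θ →ₐ[ℂ] A7 θ => G a) hF
  change star (action θ w (star a)) = action θ w a at h
  rw [← h, star_star]

/-- The elements of `A(S_θ^4)` are invariant. -/
theorem action_hopf (θ : ℝ) (w : SU2) (a : A4 θ) : action θ w (hopf θ a) = hopf θ a := by
  have e := fun i j => congrFun (congrFun (blockMatrix_mul_star w) i) j
  have e00 := e 0 0
  have e01 := e 0 1
  have e10 := e 1 0
  have e11 := e 1 1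
  have hd : w.1 0 0 * w.1 1 1 - w.1 0 1 * w.1 1 0 = 1 := by
    rw [← Matrix.det_fin_two]; exact (Matrix.mem_specialUnitaryGroup_iff.1 w.2).2
  simp only [Matrix.mul_apply, Fin.sum_univ_four, Matrix.conjTranspose_apply] at e00 e01 e10 e11
  simp [blockMatrix] at e00 e01 e10 e11
  have ha : action θ w (alpha θ) = alpha θ := by
    simp only [alpha, map_mul, map_add, map_ofNat, action_z, action_zb, Fin.sum_univ_four]
    congr 1
    simp [blockMatrix, add_mul, mul_add, smul_smul]
    linear_combination (norm := module) e00 • (z θ 0 * zb θ 2) + e01 • (z θ 0 * zb θ 3) +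
      e10 • (z θ 1 * zb θ 2) + e11 • (z θ 1 * zb θ 3)
  have hb : action θ w (beta θ) = beta θ := by
    simp only [beta, map_mul, map_add, map_neg, map_ofNat, action_z, Fin.sum_univ_four]
    congr 1
    simp [blockMatrix, add_mul, mul_add, smul_smul]
    linear_combination (norm := module) hd • (z θ 1 * z θ 2) - hd • (z θ 0 * z θ 3)
  have hx : action θ w (xx θ) = xx θ := by
    simp only [xx, map_mul, map_add, map_sub, action_z, action_zb, Fin.sum_univ_four]
    simp [blockMatrix, add_mul, mul_add, smul_smul]
    linear_combination (norm := module) e00 • (z θ 0 * zb θ 0) + e01 • (z θ 0 * zb θ 1) +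
      e10 • (z θ 1 * zb θ 0) + e11 • (z θ 1 * zb θ 1) - e00 • (z θ 2 * zb θ 2) -
      e01 • (z θ 2 * zb θ 3) - e10 • (z θ 3 * zb θ 2) - e11 • (z θ 3 * zb θ 3)
  have hF : (action θ w).comp (hopf θ) = hopf θ := by
    apply EvenSphere.hom_ext
    intro g
    change action θ w (hopf θ (EvenSphere.gen _ g)) = hopf θ (EvenSphere.gen _ g)
    rw [show hopf θ (EvenSphere.gen _ g) = hopfGen θ g from EvenSphere.lift_gen _ _ _ _ _ _ _ g]
    cases g with
    | z μ => fin_cases μ; exacts [ha, hb]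
    | zb μ =>
      fin_cases μ
      · exact (action_star θ w _).trans (congrArg star ha)
      · exact (action_star θ w _).trans (congrArg star hb)
    | x => exact hx
  exact congrArg (fun G : A4 θ →ₐ[ℂ] A7 θ => G a) hF

/-! ### Coequivariant maps -/

/-- `A(S_θ'^7)` as a right module over `A(S_θ^4)`: `b · a = b * hopf a`. -/
instance rightModule (θ : ℝ) : Module (A4 θ)ᵐᵒᵖ (A7 θ) :=
  Module.compHom (A7 θ) (RingHom.op (hopf θ : A4 θ →+* A7 θ))

theorem op_smul_eq {θ : ℝ} (a : (A4 θ)ᵐᵒᵖ) (b : A7 θ) : a • b = b * hopf θ a.unop := rfl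

instance (θ : ℝ) : SMulCommClass ℂ (A4 θ)ᵐᵒᵖ (A7 θ) :=
  ⟨fun c a b => by rw [op_smul_eq, op_smul_eq, smul_mul_assoc]⟩

instance (θ : ℝ) : SMulCommClass (A4 θ)ᵐᵒᵖ ℂ (A7 θ) := SMulCommClass.symm _ _ _

/-- The space `V^(n) = Sym^n (ℂ^2)`. -/
abbrev V (n : ℕ) : Type := Sym[ℂ]^n (Fin 2 → ℂ)

/-- The map `Sym^n (M) → Sym^n (M)` induced by a linear map. -/
def symMap (n : ℕ) {M : Type} [AddCommGroup M] [Module ℂ M] (f : M →ₗ[ℂ] M) :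
    Sym[ℂ]^n M →ₗ[ℂ] Sym[ℂ]^n M where
  toFun := AddCon.lift _
    ((SymmetricPower.mk ℂ (Fin n) M ∘ₗ PiTensorProduct.map fun _ => f).toAddMonoidHom)
    (by
      refine AddCon.addConGen_le.2 ?_
      intro x y h
      cases h with
      | perm e v =>
        change SymmetricPower.mk ℂ (Fin n) M (PiTensorProduct.map _ _) =
          SymmetricPower.mk ℂ (Fin n) M (PiTensorProduct.map _ _)
        rw [PiTensorProduct.map_tprod, PiTensorProduct.map_tprod]
        exact (SymmetricPower.tprod_equiv e fun i => f (v i)).symm)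
  map_add' := map_add _
  map_smul' c x := by
    induction x using AddCon.induction_on with
    | H t =>
      change SymmetricPower.mk ℂ (Fin n) M (PiTensorProduct.map _ (c • t)) =
        c • SymmetricPower.mk ℂ (Fin n) M (PiTensorProduct.map _ t)
      rw [map_smul, map_smul]

theorem symMap_tprod (n : ℕ) {M : Type} [AddCommGroup M] [Module ℂ M] (f : M →ₗ[ℂ] M)
    (v : Fin n → M) : symMap n f (⨂ₛ[ℂ] i, v i) = ⨂ₛ[ℂ] i, f (v i) := by
  change SymmetricPower.mk ℂ (Fin n) M (PiTensorProduct.map _ (PiTensorProduct.tprod ℂ v)) = _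
  rw [PiTensorProduct.map_tprod]
  rfl

/-- The representation `ρ_n` of `SU(2)` on `Sym^n (ℂ^2)`, acting from the right: the `n`-th
symmetric power of the action `v ↦ v w` on row vectors, so that `e_a ↦ ∑_b w_{ab} e_b`. -/
def rho (n : ℕ) (w : SU2) : V n →ₗ[ℂ] V n := symMap n (Matrix.vecMulLinear w.1)

/-- The right `A(S_θ^4)`-module of coequivariant maps: linear maps `φ : V^(n) → A(S_θ'^7)` with
`φ (v · ρ_n(w)⁻¹) = α_w (φ v)`. -/
def coequivariant (n : ℕ) (θ : ℝ) : Submodule (A4 θ)ᵐᵒᵖ (V n →ₗ[ℂ] A7 θ) where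
  carrier := {φ | ∀ (w : SU2) (v : V n), φ (rho n w⁻¹ v) = action θ w (φ v)}
  zero_mem' w v := by simp
  add_mem' {φ ψ} hφ hψ w v := by simp [hφ w v, hψ w v]
  smul_mem' a φ hφ w v := by
    simp only [LinearMap.smul_apply, op_smul_eq, map_mul, hφ w v, action_hopf]

/-! ### The vectors `φ_k` and the projection -/

/-- The words in two letters of length `n` that contain the second letter `k` times. -/
def words (n : ℕ) (k : Fin (n + 1)) : Finset (Fin n → Fin 2) :=
  Finset.univ.filter fun a => (Finset.univ.filter fun j => a j = 1).card = k

/-- The normalization constants `a_k`, with `a_k^2 = n.choose k` (`k = 0, …, n`). -/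
def normConst (n : ℕ) (k : Fin (n + 1)) : ℂ := (Real.sqrt (n.choose k) : ℝ)

/-- The normalized basis vectors `e_k` of `Sym^n (ℂ^2)` (`k = 0, …, n`): `1 / a_k` times the
symmetrization of the tensor with `n - k` factors `e_1` and `k` factors `e_2`. -/
def basisVec (n : ℕ) (k : Fin (n + 1)) : V n :=
  (normConst n k)⁻¹ • ∑ a ∈ words n k, ⨂ₛ[ℂ] j, (Pi.single (a j) 1 : Fin 2 → ℂ)

/-- The kets `ψ_1 = (z^1, -z̄^2, z^3, -z̄^4)` and `ψ_2 = (z^2, z̄^1, z^4, z̄^3)`. -/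
def ketPsi (θ : ℝ) : Fin 2 → Fin 4 → A7 θ :=
  ![![z θ 0, -zb θ 1, z θ 2, -zb θ 3], ![z θ 1, zb θ 0, z θ 3, zb θ 2]]

/-- The tensor product `ψ_{a_1} ⊗ ⋯ ⊗ ψ_{a_n}` in `A(S_θ'^7)^{4^n}`, with components
`(ψ_{a_1})_{i_1} ⋯ (ψ_{a_n})_{i_n}`. -/
def ketTensor (n : ℕ) (θ : ℝ) (a : Fin n → Fin 2) (i : Fin n → Fin 4) : A7 θ :=
  (List.ofFn fun j => ketPsi θ (a j) (i j)).prod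

/-- The kets `φ_k` (`k = 0, …, n`): `1 / a_k` times the symmetrization of
`ψ_1^{⊗ (n - k)} ⊗ ψ_2^{⊗ k}`. -/
def ketPhi (n : ℕ) (θ : ℝ) (k : Fin (n + 1)) (i : Fin n → Fin 4) : A7 θ :=
  (normConst n k)⁻¹ • ∑ a ∈ words n k, ketTensor n θ a i

/-- The pairing `⟨φ_k | f⟩ = ∑_i (φ_k)_i^* f_i` with `f ∈ A(S_θ^4)^{4^n}`. -/
def braPhi (n : ℕ) (θ : ℝ) (k : Fin (n + 1)) (f : (Fin n → Fin 4) → A4 θ) : A7 θ :=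
  ∑ i, star (ketPhi n θ k i) * hopf θ (f i)

/-- The right module `p A^N`, the range of a square matrix `p` with entries in `A`. -/
def imageModule {A I : Type} [Ring A] [Fintype I] (p : Matrix I I A) : Submodule Aᵐᵒᵖ (I → A) where
  carrier := {σ | ∃ f : I → A, σ = p *ᵥ f}
  zero_mem' := ⟨0, by simp⟩
  add_mem' := by
    rintro _ _ ⟨f, rfl⟩ ⟨g, rfl⟩
    exact ⟨f + g, by rw [Matrix.mulVec_add]⟩
  smul_mem' := by
    rintro a _ ⟨f, rfl⟩
    exact ⟨a • f, by rw [Matrix.mulVec_smul]⟩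

end NCHopf

end

/-!
The theorem rests on two facts about the inclusion of `A(S_θ^4)` in `A(S_θ'^7)`: it is injective
(`hopf_injective`), and its image consists of all `SU(2)`-invariant elements
(`exists_hopf_eq_of_invariant`).

*Injectivity.* By the commutation relations and the sphere relation, `A(S_θ^4)` is spanned by the
reduced monomials `α^p β^q (α α^*)^j x^k` with `p, q ∈ ℤ` (`span_redMon`).  To see that their images
are independent, represent `A(S_θ'^7)` on functions on `ℤ²` by multiples of twisted translations
(`slice`): the pair `(p, q)` can be read off from where `δ_0` is moved, and letting the scalars of
the representation vary separates the polynomials in `α α^*` and `x`.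

*Invariants.* The components `ψ_{a,i}` of the two kets generate `A(S_θ'^7)`, and the antisymmetric
combinations `ψ_{1,i} ψ_{2,j} - ψ_{2,i} ψ_{1,j}` lie in `A(S_θ^4)`.  Hence, up to shorter words with
coefficients in `A(S_θ^4)`, a word `ψ_{a_1,i_1} ⋯ ψ_{a_n,i_n}` does not depend on the order of the
letters `a_1, …, a_n`, and so `A(S_θ'^7)` is generated over `A(S_θ^4)` by the products
`ψ(v)_{i_1} ⋯ ψ(v)_{i_n}` with `ψ(v) = v_1 ψ_1 + v_2 ψ_2`, `v ∈ ℂ²` (`span_ketPower`).  The Haar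
average over `SU(2)` of such a product vanishes for `n > 0`: it is unchanged when `v` is replaced by
`w v`, while for a suitable `w ∈ SU(2)` with eigenvector `v` this replacement changes the sign.  So
the average of any element lies in `A(S_θ^4)`, and an invariant element is its own average.

*The isomorphism.* The kets are orthonormal, `⟨φ_k | φ_l⟩ = δ_{kl}` (`sum_star_ketPhi_mul`), because
`ψ_1` and `ψ_2` are.  The maps `e_k ↦ (φ_k)_i^*` are coequivariant (`braMap`), hence so is
`e_k ↦ ⟨φ_k | f⟩`.  Conversely, if `φ` is coequivariant, then `∑_k |φ_k⟩ φ(e_k)` has invariant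
components (`action_sum_ketPhi_mul`), hence components in `A(S_θ^4)`.  With `φ = (e_k ↦ (φ_k)_j^*)`
this gives the entries of the projection, and in general it gives the inverse of the map
`p |f⟩ ↦ (e_k ↦ ⟨φ_k | f⟩)`.
-/

noncomputable section

namespace NCHopf

/-! ### Spanning `A(S_θ^4)` by reduced monomials -/

/-- A subspace of `A(S_Θ^{2n})` that contains `1` and is stable under left multiplication by the
generators is everything. -/
theorem EvenSphere.eq_top_of_mul_mem {n : ℕ} {Θ : Matrix (Fin n) (Fin n) ℝ}
    (N : Submodule ℂ (EvenSphere Θ)) (h1 : 1 ∈ N)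
    (hN : ∀ g, ∀ a ∈ N, EvenSphere.gen Θ g * a ∈ N) : N = ⊤ := by
  have key : ∀ (p : FreeAlgebra ℂ (OddGen n)), ∀ a ∈ N, EvenSphere.mk Θ p * a ∈ N := by
    intro p
    induction p using FreeAlgebra.induction with
    | grade0 r =>
      intro a ha
      rw [AlgHom.commutes, ← Algebra.smul_def]
      exact N.smul_mem r ha
    | grade1 g => exact hN g
    | mul p q hp hq =>
      intro a ha
      rw [map_mul, mul_assoc]
      exact hp _ (hq _ ha)
    | add p q hp hq =>
      intro a ha
      rw [map_add, add_mul]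
      exact N.add_mem (hp _ ha) (hq _ ha)
  rw [eq_top_iff]
  intro a _
  obtain ⟨p, rfl⟩ := RingQuot.mkAlgHom_surjective ℂ (EvenSphereRel Θ) a
  have h := key p 1 h1
  rw [mul_one] at h
  exact h

/-- The powers `g ^ p` for `p ≥ 0` and `g' ^ (-p)` for `p < 0`: integer powers in which the second
element stands in for the inverse of the first. -/
def ladder {A : Type} [Monoid A] (g g' : A) : ℤ → A
  | Int.ofNat n => g ^ n
  | Int.negSucc n => g' ^ (n + 1)

section Ladder

variable {A : Type} [Ring A] {g g' y : A}

theorem ladder_zero {A : Type} [Monoid A] (g g' : A) : ladder g g' 0 = 1 := pow_zero g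

theorem mul_ladder (h : g' * g = g * g') (p : ℤ) :
    ∃ e : ℕ, g * ladder g g' p = ladder g g' (p + 1) * (g * g') ^ e := by
  cases p with
  | ofNat n => exact ⟨0, by rw [pow_zero, mul_one]; exact (pow_succ' g n).symm⟩
  | negSucc n =>
    refine ⟨1, ?_⟩
    have hc : Commute (g * g') (g' ^ n) :=
      Commute.pow_right (Commute.mul_left (show Commute g g' from h.symm) (Commute.refl _)) n
    have e : ladder g g' (Int.negSucc n + 1) = g' ^ n := by
      cases n with
      | zero => exact (ladder_zero g g').trans (pow_zero g').symm
      | succ k =>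
        rw [show Int.negSucc (k + 1) + 1 = Int.negSucc k by omega]
        rfl
    rw [e, pow_one, ← hc.eq, mul_assoc, ← pow_succ']
    rfl

theorem mul_ladder' (h : g' * g = g * g') (p : ℤ) :
    ∃ e : ℕ, g' * ladder g g' p = ladder g g' (p - 1) * (g * g') ^ e := by
  have hc : ∀ n : ℕ, Commute (g * g') (g ^ n) := fun n =>
    Commute.pow_right (Commute.mul_left (Commute.refl _) (show Commute g' g from h)) n
  rcases p with n | n
  · cases n with
    | zero => exact ⟨0, show g' * g ^ 0 = g' ^ (0 + 1) * (g * g') ^ 0 by simp⟩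
    | succ k =>
      refine ⟨1, ?_⟩
      rw [show Int.ofNat (k + 1) - 1 = Int.ofNat k by simp]
      change g' * g ^ (k + 1) = g ^ k * (g * g') ^ 1
      rw [pow_one, ← (hc k).eq, ← h, mul_assoc, ← pow_succ']
  · refine ⟨0, ?_⟩
    rw [show Int.negSucc n - 1 = Int.negSucc (n + 1) by omega, pow_zero, mul_one]
    exact (pow_succ' g' (n + 1)).symm

variable [Algebra ℂ A]

theorem mul_pow_eq_smul {c : ℂ} (h : y * g = c • (g * y)) (n : ℕ) :
    y * g ^ n = c ^ n • (g ^ n * y) := by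
  induction n with
  | zero => simp
  | succ k ih =>
    rw [pow_succ, ← mul_assoc, ih, smul_mul_assoc, mul_assoc, h, mul_smul_comm, smul_smul,
      mul_assoc, pow_succ]

theorem mul_ladder_eq_smul {c c' : ℂ} (h : y * g = c • (g * y)) (h' : y * g' = c' • (g' * y))
    (p : ℤ) : ∃ k : ℂ, y * ladder g g' p = k • (ladder g g' p * y) := by
  cases p with
  | ofNat n => exact ⟨_, mul_pow_eq_smul h n⟩
  | negSucc n => exact ⟨_, mul_pow_eq_smul h' _⟩

theorem map_ladder {B : Type} [Ring B] [Algebra ℂ B] (f : A →ₐ[ℂ] B) (g g' : A) (p : ℤ) :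
    f (ladder g g' p) = ladder (f g) (f g') p := by
  cases p <;> exact map_pow f _ _

end Ladder

/-- The reduced monomials `α^p β^q (α α^*)^j x^k` of `A(S_θ^4)`, with `p, q ∈ ℤ`, where negative
powers are powers of the adjoint. -/
def redMon (θ : ℝ) (d : (ℤ × ℤ) × (Fin 2 →₀ ℕ)) : A4 θ :=
  ladder (EvenSphere.gen (theta4 θ) (.z 0)) (EvenSphere.gen _ (.zb 0)) d.1.1 *
    ladder (EvenSphere.gen (theta4 θ) (.z 1)) (EvenSphere.gen _ (.zb 1)) d.1.2 *
    ((EvenSphere.gen _ (.z 0) * EvenSphere.gen _ (.zb 0)) ^ d.2 0 * EvenSphere.gen _ .x ^ d.2 1)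

theorem span_redMon (θ : ℝ) : Submodule.span ℂ (Set.range (redMon θ)) = ⊤ := by
  set N := Submodule.span ℂ (Set.range (redMon θ)) with hN
  have hlam : ∀ i, lam (theta4 θ) i i = 1 := by
    intro i; fin_cases i <;> simp [lam, theta4]
  set a := EvenSphere.gen (theta4 θ) (.z 0) with ha
  set a' := EvenSphere.gen (theta4 θ) (.zb 0) with ha'
  set b := EvenSphere.gen (theta4 θ) (.z 1) with hb
  set b' := EvenSphere.gen (theta4 θ) (.zb 1) with hb'
  set x := EvenSphere.gen (theta4 θ) .x with hx
  have haa : a' * a = a * a' := by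
    have := EvenSphere.zbz (theta4 θ) 0 0
    rwa [hlam, one_smul] at this
  have hbb : b' * b = b * b' := by
    have := EvenSphere.zbz (theta4 θ) 1 1
    rwa [hlam, one_smul] at this
  have hsph : b * b' = 1 - a * a' - x * x := by
    have := EvenSphere.sphere (theta4 θ)
    rw [Fin.sum_univ_two] at this
    rw [← this]; simp only [ha, ha', hx, hb, hb']; abel
  have hxa : Commute x a := EvenSphere.xz (theta4 θ) 0
  have hxa' : Commute x a' := EvenSphere.xzb (theta4 θ) 0
  have hxb : Commute x b := EvenSphere.xz (theta4 θ) 1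
  have hxb' : Commute x b' := EvenSphere.xzb (theta4 θ) 1
  have hba : b * a = lam (theta4 θ) 1 0 • (a * b) := EvenSphere.zz _ 1 0
  have hb'a' : b' * a' = lam (theta4 θ) 1 0 • (a' * b') := EvenSphere.zbzb _ 1 0
  have hb'a : b' * a = lam (theta4 θ) 0 1 • (a * b') := EvenSphere.zbz _ 1 0
  have hll : lam (theta4 θ) 0 1 * lam (theta4 θ) 1 0 = 1 := by
    rw [lam, lam, ← Complex.exp_add]; simp [theta4]
  have hba' : b * a' = lam (theta4 θ) 0 1 • (a' * b) := by
    have h : a' * b = lam (theta4 θ) 1 0 • (b * a') := EvenSphere.zbz _ 0 1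
    rw [h, smul_smul, hll, one_smul]
  have hbs : Commute b (a * a') := by
    change b * (a * a') = a * a' * b
    rw [← mul_assoc, hba, smul_mul_assoc, mul_assoc, hba', mul_smul_comm, smul_smul, mul_comm,
      hll, one_smul, mul_assoc]
  have hb's : Commute b' (a * a') := by
    change b' * (a * a') = a * a' * b'
    rw [← mul_assoc, hb'a, smul_mul_assoc, mul_assoc, hb'a', mul_smul_comm, smul_smul,
      hll, one_smul, mul_assoc]
  have hxs : Commute x (a * a') := hxa.mul_right hxa'
  have hlad : ∀ (y g g' : A4 θ), Commute y g → Commute y g' → ∀ p, Commute y (ladder g g' p) := by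
    intro y g g' h h' p
    cases p with
    | ofNat n => exact h.pow_right n
    | negSucc n => exact h'.pow_right _
  have hmem : ∀ (p q : ℤ) (j k : ℕ),
      ladder a a' p * ladder b b' q * ((a * a') ^ j * x ^ k) ∈ N := by
    intro p q j k
    refine Submodule.subset_span ⟨((p, q), Finsupp.single 0 j + Finsupp.single 1 k), ?_⟩
    simp [redMon, ha, ha', hb, hb', hx]
  -- powers of `β β^*` are eliminated by the sphere relation
  have hmem2 : ∀ (p q : ℤ) (e j k : ℕ),
      ladder a a' p * ladder b b' q * ((b * b') ^ e * ((a * a') ^ j * x ^ k)) ∈ N := by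
    intro p q e
    induction e with
    | zero => intro j k; simpa using hmem p q j k
    | succ e ih =>
      intro j k
      have e1 : (b * b') ^ (e + 1) * ((a * a') ^ j * x ^ k) =
          (b * b') ^ e * ((a * a') ^ j * x ^ k) - (b * b') ^ e * ((a * a') ^ (j + 1) * x ^ k) -
            (b * b') ^ e * ((a * a') ^ j * x ^ (k + 2)) := by
        have e2 : (a * a') * ((a * a') ^ j * x ^ k) = (a * a') ^ (j + 1) * x ^ k := by
          rw [pow_succ' _ j, mul_assoc (a * a')]
        have e3 : (x * x) * ((a * a') ^ j * x ^ k) = (a * a') ^ j * x ^ (k + 2) := by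
          rw [← mul_assoc, ((hxs.mul_left hxs).pow_right j).eq, mul_assoc, add_comm k 2, pow_add,
            pow_two]
        rw [pow_succ, mul_assoc, ← e2, ← e3, ← mul_sub, ← mul_sub]
        congr 1
        rw [hsph, sub_mul, sub_mul, one_mul]
      rw [e1, mul_sub, mul_sub]
      exact N.sub_mem (N.sub_mem (ih _ _) (ih _ _)) (ih _ _)
  refine EvenSphere.eq_top_of_mul_mem N ?_ ?_
  · have := hmem 0 0 0 0
    simpa [ladder_zero] using this
  · intro g y hy
    induction hy using Submodule.span_induction with
    | zero => simp
    | add u v _ _ hu hv => rw [mul_add]; exact N.add_mem hu hv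
    | smul c u _ hu => rw [mul_smul_comm]; exact N.smul_mem c hu
    | mem u hu =>
      obtain ⟨⟨⟨p, q⟩, r⟩, rfl⟩ := hu
      change EvenSphere.gen _ g * (ladder a a' p * ladder b b' q * ((a * a') ^ r 0 * x ^ r 1)) ∈ N
      generalize r 0 = j
      generalize r 1 = k
      have case_a : ∀ (y : A4 θ) (p' : ℤ) (e : ℕ),
          y * ladder a a' p = ladder a a' p' * (a * a') ^ e →
          y * (ladder a a' p * ladder b b' q * ((a * a') ^ j * x ^ k)) ∈ N := by
        intro y p' e h
        have hc : Commute ((a * a') ^ e) (ladder b b' q) :=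
          (hlad _ _ _ hbs.symm hb's.symm q).pow_left e
        have e1 : y * (ladder a a' p * ladder b b' q * ((a * a') ^ j * x ^ k)) =
            ladder a a' p' * ladder b b' q * ((a * a') ^ (e + j) * x ^ k) := by
          calc _ = (y * ladder a a' p) * ladder b b' q * ((a * a') ^ j * x ^ k) := by
                simp only [mul_assoc]
            _ = ladder a a' p' * ((a * a') ^ e * ladder b b' q) * ((a * a') ^ j * x ^ k) := by
                rw [h]; simp only [mul_assoc]
            _ = _ := by rw [hc.eq, pow_add]; simp only [mul_assoc]
        exact e1 ▸ hmem _ _ _ _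
      have case_b : ∀ (y : A4 θ) (κ : ℂ) (q' : ℤ) (e : ℕ),
          y * ladder a a' p = κ • (ladder a a' p * y) →
          y * ladder b b' q = ladder b b' q' * (b * b') ^ e →
          y * (ladder a a' p * ladder b b' q * ((a * a') ^ j * x ^ k)) ∈ N := by
        intro y κ q' e h h'
        have e1 : y * (ladder a a' p * ladder b b' q * ((a * a') ^ j * x ^ k)) =
            κ • (ladder a a' p * ladder b b' q' * ((b * b') ^ e * ((a * a') ^ j * x ^ k))) := by
          calc _ = (y * ladder a a' p) * ladder b b' q * ((a * a') ^ j * x ^ k) := by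
                simp only [mul_assoc]
            _ = κ • (ladder a a' p * (y * ladder b b' q) * ((a * a') ^ j * x ^ k)) := by
                rw [h]; simp only [mul_assoc, smul_mul_assoc]
            _ = _ := by rw [h']; simp only [mul_assoc]
        exact e1 ▸ N.smul_mem _ (hmem2 _ _ _ _ _)
      rcases g with i | i | _
      · fin_cases i
        · obtain ⟨e, he⟩ := mul_ladder haa p
          exact case_a _ _ e he
        · obtain ⟨κ, hκ⟩ := mul_ladder_eq_smul hba hba' p
          obtain ⟨e, he⟩ := mul_ladder hbb q
          exact case_b _ κ _ e hκ he
      · fin_cases i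
        · obtain ⟨e, he⟩ := mul_ladder' haa p
          exact case_a _ _ e he
        · obtain ⟨κ, hκ⟩ := mul_ladder_eq_smul hb'a hb'a' p
          obtain ⟨e, he⟩ := mul_ladder' hbb q
          exact case_b _ κ _ e hκ he
      · have h1 := (hlad x _ _ hxa hxa' p).mul_right (hlad x _ _ hxb hxb' q)
        have h2 : x * (ladder a a' p * ladder b b' q * ((a * a') ^ j * x ^ k)) =
            ladder a a' p * ladder b b' q * ((a * a') ^ j * x ^ (k + 1)) := by
          rw [← mul_assoc, h1.eq, mul_assoc (ladder a a' p * _), ← mul_assoc x,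
            (hxs.pow_right j).eq, mul_assoc ((a * a') ^ j), ← pow_succ']
        exact h2 ▸ hmem _ _ _ _

/-! ### Representations of `A(S_θ'^7)` and injectivity of the inclusion -/

/-- The translation by `v` on functions on `ℤ²`, twisted by a phase so that translations commute up
to the factor of `A(S_θ'^7)`. -/
def twist (θ : ℝ) (v : ℤ × ℤ) : Module.End ℂ (ℤ × ℤ → ℂ) where
  toFun f m := factor (θ / 2) v m * f (m - v)
  map_add' f g := by ext m; simp [mul_add]
  map_smul' c f := by ext m; simp [mul_left_comm]

theorem factor_neg_right_swap (θ : ℝ) (v w : ℤ × ℤ) : factor θ w (-v) = factor θ v w := by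
  rw [factor, factor]
  congr 1
  push_cast [Prod.fst_neg, Prod.snd_neg]
  ring

theorem factor_self (θ : ℝ) (v : ℤ × ℤ) : factor θ v v = 1 := by
  simp [factor, mul_comm]

theorem factor_ne_zero (θ : ℝ) (v w : ℤ × ℤ) : factor θ v w ≠ 0 := Complex.exp_ne_zero _

theorem twist_mul (θ : ℝ) (v w : ℤ × ℤ) :
    twist θ v * twist θ w = factor (θ / 2) v w • twist θ (v + w) := by
  refine LinearMap.ext fun f => funext fun m => ?_
  change factor (θ / 2) v m * (factor (θ / 2) w (m - v) * f (m - v - w)) =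
    factor (θ / 2) v w * (factor (θ / 2) (v + w) m * f (m - (v + w)))
  rw [sub_eq_add_neg m v, factor_add_right, factor_neg_right_swap, factor_add_left,
    ← sub_eq_add_neg, sub_sub]
  ring

theorem twist_zero (θ : ℝ) : twist θ 0 = 1 := by
  refine LinearMap.ext fun f => funext fun m => ?_
  change factor (θ / 2) 0 m * f (m - 0) = f m
  rw [factor_zero_left, one_mul, sub_zero]

theorem twist_mul_neg (θ : ℝ) (v w : ℤ × ℤ) (h : v + w = 0) : twist θ v * twist θ w = 1 := by
  obtain rfl := eq_neg_of_add_eq_zero_right h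
  rw [twist_mul, h, twist_zero, factor_neg_right_swap, factor_self, one_smul]

theorem twist_pow (θ : ℝ) (v : ℤ × ℤ) (n : ℕ) : twist θ v ^ n = twist θ ((n : ℤ) • v) := by
  induction n with
  | zero => simp [twist_zero]
  | succ k ih =>
    have e : factor (θ / 2) ((k : ℤ) • v) v = 1 := by
      rw [factor]
      simp [mul_comm, mul_left_comm]
    rw [pow_succ, ih, twist_mul, Nat.cast_succ, add_smul, one_smul, e, one_smul]

theorem twist_comm (θ : ℝ) (v w : ℤ × ℤ) :
    twist θ v * twist θ w = factor θ v w • (twist θ w * twist θ v) := by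
  rw [twist_mul, twist_mul, smul_smul, add_comm w v]
  congr 1
  rw [factor, factor, factor, ← Complex.exp_add]
  congr 1
  push_cast
  ring

theorem twist_single (θ : ℝ) (v m : ℤ × ℤ) :
    twist θ v (Pi.single 0 1) m = if m = v then 1 else 0 := by
  change factor (θ / 2) v m * (Pi.single 0 1 : ℤ × ℤ → ℂ) (m - v) = _
  by_cases h : m = v
  · rw [h, factor_self, sub_self, Pi.single_eq_same, if_pos rfl, one_mul]
  · rw [Pi.single_eq_of_ne (sub_ne_zero.2 h), if_neg h, mul_zero]

/-- The representation of `A(S_θ'^7)` on functions on `ℤ²` attached to numbers `R + C + D = 1`: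
up to normalization, the points of `S^7` with coordinates of square moduli `R, 0, C, D`, whose
phases are made into twisted translations. -/
def slice (θ : ℝ) (R C D : ℂ) (h : R + C + D = 1) : A7 θ →ₐ[ℂ] Module.End ℂ (ℤ × ℤ → ℂ) :=
  OddSphere.lift (fun g => (match g with
      | .z μ => ![R, 0, C, D] μ
      | .zb μ => ![1, 0, 1, 1] μ : ℂ) • twist θ (genDegree g))
    (fun μ ν => by
      have e : factor θ (genDegree (.z μ)) (genDegree (.z ν)) = lam (theta7 θ) μ ν := by
        fin_cases μ <;> fin_cases ν <;> simp [factor, genDegree, lam, theta7]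
      rw [smul_mul_smul_comm, smul_mul_smul_comm, twist_comm, e, smul_comm, mul_comm])
    (fun μ ν => by
      have e : factor θ (genDegree (.zb μ)) (genDegree (.z ν)) = lam (theta7 θ) ν μ := by
        fin_cases μ <;> fin_cases ν <;> simp [factor, genDegree, lam, theta7]
      rw [smul_mul_smul_comm, smul_mul_smul_comm, twist_comm, e, smul_comm, mul_comm])
    (fun μ ν => by
      have e : factor θ (genDegree (.zb μ)) (genDegree (.zb ν)) = lam (theta7 θ) μ ν := by
        fin_cases μ <;> fin_cases ν <;> simp [factor, genDegree, lam, theta7]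
      rw [smul_mul_smul_comm, smul_mul_smul_comm, twist_comm, e, smul_comm, mul_comm])
    (by
      have e : ∀ μ, twist θ (genDegree (.z μ)) * twist θ (genDegree (.zb μ)) = 1 := fun μ =>
        twist_mul_neg θ _ _ (by fin_cases μ <;> simp [genDegree])
      simp only [smul_mul_smul_comm, e, ← Finset.sum_smul, Fin.sum_univ_four]
      simp [h])

section Slice

variable {θ : ℝ} {R C D : ℂ} (h : R + C + D = 1)

theorem slice_z (μ : Fin 4) :
    slice θ R C D h (z θ μ) = ![R, 0, C, D] μ • twist θ (genDegree (.z μ)) :=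
  OddSphere.lift_gen _ _ _ _ _ _

theorem slice_zb (μ : Fin 4) :
    slice θ R C D h (zb θ μ) = (![1, 0, 1, 1] μ : ℂ) • twist θ (genDegree (.zb μ)) :=
  OddSphere.lift_gen _ _ _ _ _ _

theorem slice_alpha : slice θ R C D h (alpha θ) =
    (2 * R * factor (θ / 2) (1, 0) (0, -1)) • twist θ (1, -1) := by
  simp [alpha, slice_z, slice_zb, genDegree, twist_mul, smul_smul, two_mul]
  module

theorem slice_star_alpha : slice θ R C D h (star (alpha θ)) =
    (2 * C * factor (θ / 2) (0, 1) (-1, 0)) • twist θ (-1, 1) := by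
  simp [star_alpha, slice_z, slice_zb, genDegree, twist_mul, smul_smul, two_mul]
  module

theorem slice_beta : slice θ R C D h (beta θ) =
    (-(2 * R * D * factor (θ / 2) (1, 0) (0, 1))) • twist θ (1, 1) := by
  simp [beta, slice_z, genDegree, twist_mul, smul_smul, two_mul]
  module

theorem slice_star_beta : slice θ R C D h (star (beta θ)) =
    (-(2 * factor (θ / 2) (0, -1) (-1, 0))) • twist θ (-1, -1) := by
  simp [star_beta, slice_zb, genDegree, twist_mul, two_mul, add_smul]

theorem slice_xx : slice θ R C D h (xx θ) = (2 * R - 1) • 1 := by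
  have e : ∀ μ, twist θ (genDegree (.z μ)) * twist θ (genDegree (.zb μ)) = 1 := fun μ =>
    twist_mul_neg θ _ _ (by fin_cases μ <;> simp [genDegree])
  simp only [xx, map_add, map_sub, map_mul, slice_z, slice_zb, smul_mul_smul_comm, e,
    ← add_smul, ← sub_smul]
  congr 1
  simp
  linear_combination -h

theorem slice_alpha_mul_star :
    slice θ R C D h (alpha θ * star (alpha θ)) = (4 * R * C) • 1 := by
  rw [map_mul, slice_alpha, slice_star_alpha, smul_mul_smul_comm, twist_mul_neg θ _ _ rfl]
  congr 1
  have e : factor (θ / 2) (1, 0) (0, -1) * factor (θ / 2) (0, 1) (-1, 0) = 1 := by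
    rw [factor, factor, ← Complex.exp_add]; simp
  linear_combination 4 * R * C * e

theorem ladder_smul_twist {a b : ℂ} (ha : a ≠ 0) (hb : b ≠ 0) (v w : ℤ × ℤ) (hw : w = -v) (p : ℤ) :
    ∃ c : ℂ, c ≠ 0 ∧ ladder (a • twist θ v) (b • twist θ w) p = c • twist θ (p • v) := by
  subst hw
  cases p with
  | ofNat n => exact ⟨a ^ n, pow_ne_zero _ ha, (smul_pow _ _ _).trans (by rw [twist_pow]; rfl)⟩
  | negSucc n =>
    refine ⟨b ^ (n + 1), pow_ne_zero _ hb, (smul_pow _ _ _).trans ?_⟩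
    rw [twist_pow, smul_neg, ← neg_smul]
    rfl

theorem hopf_gen (θ : ℝ) (g : OddGen 2) : hopf θ (EvenSphere.gen _ g) = hopfGen θ g :=
  EvenSphere.lift_gen _ _ _ _ _ _ _ g

/-- The reduced monomial with exponents `p, q, j, k` acts as `(4RC)^j (2R - 1)^k` times a nonzero
multiple, depending only on `p` and `q`, of the twisted translation by `(p + q, q - p)`. -/
theorem slice_redMon (hR : R ≠ 0) (hC : C ≠ 0) (hD : D ≠ 0) (p q : ℤ) :
    ∃ c : ℂ, c ≠ 0 ∧ ∀ e : Fin 2 →₀ ℕ, slice θ R C D h (hopf θ (redMon θ ((p, q), e))) =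
      (c * ((4 * R * C) ^ e 0 * (2 * R - 1) ^ e 1)) • twist θ (p + q, q - p) := by
  obtain ⟨c1, h1, e1⟩ := ladder_smul_twist (θ := θ)
    (a := 2 * R * factor (θ / 2) (1, 0) (0, -1)) (b := 2 * C * factor (θ / 2) (0, 1) (-1, 0))
    (by simp [hR, factor_ne_zero]) (by simp [hC, factor_ne_zero]) (1, -1) (-1, 1) rfl p
  obtain ⟨c2, h2, e2⟩ := ladder_smul_twist (θ := θ)
    (a := -(2 * R * D * factor (θ / 2) (1, 0) (0, 1)))
    (b := -(2 * factor (θ / 2) (0, -1) (-1, 0)))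
    (by simp [hR, hD, factor_ne_zero]) (by simp [factor_ne_zero]) (1, 1) (-1, -1) rfl q
  refine ⟨c1 * c2 * factor (θ / 2) (p • (1, -1)) (q • (1, 1)),
    mul_ne_zero (mul_ne_zero h1 h2) (factor_ne_zero _ _ _), fun e => ?_⟩
  have ha : hopf θ (EvenSphere.gen _ (.z 0)) = alpha θ := hopf_gen θ _
  have ha' : hopf θ (EvenSphere.gen _ (.zb 0)) = star (alpha θ) := hopf_gen θ _
  have hb : hopf θ (EvenSphere.gen _ (.z 1)) = beta θ := hopf_gen θ _
  have hb' : hopf θ (EvenSphere.gen _ (.zb 1)) = star (beta θ) := hopf_gen θ _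
  have hx : hopf θ (EvenSphere.gen _ .x) = xx θ := hopf_gen θ _
  rw [redMon]
  simp only [map_mul, map_pow, map_ladder, ha, ha', hb, hb', hx]
  rw [← map_mul, slice_alpha_mul_star, slice_xx, slice_alpha, slice_star_alpha, slice_beta,
    slice_star_beta, e1, e2, smul_pow, smul_pow, one_pow, one_pow, smul_mul_smul_comm,
    smul_mul_smul_comm, smul_mul_smul_comm, twist_mul, mul_one, mul_one, smul_smul]
  congr 1
  · ring
  · congr 1
    ext
    · simp
    · simp
      ring

end Slice

/-- In the representations `slice`, the monomials with different `(p, q)` move `δ_0` to different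
points, and those with the same `(p, q)` are independent polynomial functions of `R` and `C`. -/
theorem linearIndependent_hopf_redMon (θ : ℝ) :
    LinearIndependent ℂ fun d => hopf θ (redMon θ d) := by
  rw [linearIndependent_iff]
  intro l hl
  ext ⟨⟨p, q⟩, e⟩
  -- the part of the combination with exponents `p`, `q`, as a polynomial in `α α^*` and `x`
  let P : MvPolynomial (Fin 2) ℂ :=
    l.sum fun d c => if d.1 = (p, q) then MvPolynomial.monomial d.2 c else 0
  have hcoeff : P.coeff e = l ((p, q), e) := by
    simp only [P, Finsupp.sum, MvPolynomial.coeff_sum]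
    rw [Finset.sum_eq_single ((p, q), e)]
    · simp
    · rintro ⟨d, e'⟩ - hd
      by_cases h : d = (p, q)
      · have : e' ≠ e := fun h' => hd (by rw [h, h'])
        simp [h, MvPolynomial.coeff_monomial, this]
      · simp [h]
    · intro h
      simp [Finsupp.notMem_support_iff.1 h]
  have hvan : ∀ R C : ℂ, R ≠ 0 → C ≠ 0 → 1 - R - C ≠ 0 →
      MvPolynomial.eval ![4 * R * C, 2 * R - 1] P = 0 := by
    intro R C hR hC hD
    have h : R + C + (1 - R - C) = 1 := by ring
    obtain ⟨c, hc, hpq⟩ := slice_redMon (θ := θ) h hR hC hD p q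
    have hsum := congrArg (fun a => slice θ R C _ h a (Pi.single 0 1) (p + q, q - p)) hl
    simp only [Finsupp.linearCombination_apply, Finsupp.sum, map_sum, map_smul, map_zero,
      LinearMap.sum_apply, LinearMap.smul_apply, LinearMap.zero_apply, Finset.sum_apply,
      Pi.smul_apply, Pi.zero_apply] at hsum
    refine (mul_eq_zero.1 (?_ : c * _ = 0)).resolve_left hc
    rw [← hsum]
    simp only [P, Finsupp.sum, map_sum, Finset.mul_sum]
    refine Finset.sum_congr rfl ?_
    rintro ⟨⟨p', q'⟩, e'⟩ -
    by_cases hd : (p', q') = (p, q)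
    · obtain ⟨rfl, rfl⟩ := Prod.mk.inj hd
      rw [hpq, LinearMap.smul_apply, Pi.smul_apply, twist_single, if_pos rfl, if_pos rfl,
        MvPolynomial.eval_monomial]
      simp only [Finsupp.prod_fintype _ _ fun i => pow_zero _, Fin.prod_univ_two, smul_eq_mul]
      simp
      ring
    · obtain ⟨c', -, h'⟩ := slice_redMon (θ := θ) h hR hC hD p' q'
      have hne : (p + q, q - p) ≠ (p' + q', q' - p') := fun hh => hd (by
        obtain ⟨h1, h2⟩ := Prod.mk.inj hh
        ext <;> simp <;> omega)
      rw [h', LinearMap.smul_apply, Pi.smul_apply, twist_single, if_neg hne, if_neg hd]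
      simp
  -- the extra factors vanish where `R`, `C` or `1 - R - C` would be zero or undefined
  have hP : P * (MvPolynomial.X 0 * (1 - MvPolynomial.X 1 * MvPolynomial.X 1) *
      (1 - MvPolynomial.X 1 * MvPolynomial.X 1 - MvPolynomial.X 0)) = 0 := by
    refine MvPolynomial.funext fun s => ?_
    rw [map_mul, map_zero, mul_eq_zero, or_iff_not_imp_right]
    intro hs
    simp only [map_mul, map_sub, map_one, MvPolynomial.eval_X, mul_eq_zero, not_or] at hs
    obtain ⟨⟨h0, h1⟩, h2⟩ := hs
    have hy : 1 + s 1 ≠ 0 := fun h => h1 (by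
      rw [show s 1 = -1 by linear_combination h]; ring)
    -- `R` and `C` are chosen so that `4 R C = s 0` and `2 R - 1 = s 1`
    have := hvan ((1 + s 1) / 2) (s 0 / (2 * (1 + s 1))) (div_ne_zero hy two_ne_zero)
      (div_ne_zero h0 (mul_ne_zero two_ne_zero hy)) (fun h => h2 (by
        field_simp at h
        linear_combination h))
    rw [← this]
    congr 2
    ext i
    fin_cases i
    · simp; field_simp; norm_num
    · simp; field_simp; ring
  have hne : ∀ s : Fin 2 → ℂ, ∀ Q : MvPolynomial (Fin 2) ℂ, MvPolynomial.eval s Q ≠ 0 → Q ≠ 0 := by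
    rintro s Q h rfl
    exact h (map_zero _)
  have hP0 : P = 0 := by
    refine (mul_eq_zero.1 hP).resolve_right (hne ![2, 0] _ ?_)
    simp
    norm_num
  rw [← hcoeff, hP0]
  rfl

/-- The reduced monomials span `A(S_θ^4)` and have independent images. -/
theorem hopf_injective (θ : ℝ) : Function.Injective (hopf θ) := by
  rw [injective_iff_map_eq_zero]
  intro a ha
  have h : a ∈ Submodule.span ℂ (Set.range (redMon θ)) := span_redMon θ ▸ Submodule.mem_top
  obtain ⟨l, rfl⟩ := Finsupp.mem_span_range_iff_exists_finsupp.1 h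
  have h0 : l = 0 := by
    refine linearIndependent_iff.1 (linearIndependent_hopf_redMon θ) l ?_
    rw [← ha, map_finsuppSum, Finsupp.linearCombination_apply]
    simp
  rw [h0, Finsupp.sum_zero_index]

/-! ### The kets `ψ_1` and `ψ_2` -/

/-- The bidegree of the `i`-th components of `ψ_1` and `ψ_2`. -/
def rowDegree : Fin 4 → ℤ × ℤ := ![(1, 0), (-1, 0), (0, 1), (0, -1)]

theorem hasDegree_ketPsi (θ : ℝ) (a : Fin 2) (i : Fin 4) :
    HasDegree θ (rowDegree i) (ketPsi θ a i) := by
  fin_cases a <;> fin_cases i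
  exacts [hasDegree_z θ 0, .neg (hasDegree_zb θ 1), hasDegree_z θ 2, .neg (hasDegree_zb θ 3),
    hasDegree_z θ 1, hasDegree_zb θ 0, hasDegree_z θ 3, hasDegree_zb θ 2]

theorem sum_star_ketPsi_mul_ketPsi (θ : ℝ) (a b : Fin 2) :
    ∑ i, star (ketPsi θ a i) * ketPsi θ b i = if a = b then 1 else 0 := by
  have hs := OddSphere.sphere (theta7 θ)
  rw [Fin.sum_univ_four] at hs
  change z θ 0 * zb θ 0 + z θ 1 * zb θ 1 + z θ 2 * zb θ 2 + z θ 3 * zb θ 3 = 1 at hs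
  have bz : ∀ i j : Fin 4, factor θ (genDegree (.zb i)) (genDegree (.z j)) = 1 →
      zb θ i * z θ j = z θ j * zb θ i := fun i j h => by
    rw [(hasDegree_zb θ i).comm (hasDegree_z θ j), h, one_smul]
  have e00 := bz 0 0 (by simp [factor, genDegree])
  have e11 := bz 1 1 (by simp [factor, genDegree])
  have e22 := bz 2 2 (by simp [factor, genDegree])
  have e33 := bz 3 3 (by simp [factor, genDegree])
  have e01 := bz 0 1 (by simp [factor, genDegree])
  have e10 := bz 1 0 (by simp [factor, genDegree])
  have e23 := bz 2 3 (by simp [factor, genDegree])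
  have e32 := bz 3 2 (by simp [factor, genDegree])
  rw [Fin.sum_univ_four]
  fin_cases a <;> fin_cases b <;>
    simp [ketPsi, star_z, star_zb, e00, e11, e22, e33, e01, e10, e23, e32, ← hs]
  abel

theorem SU2_apply_one_one (w : SU2) : w.1 1 1 = star (w.1 0 0) ∧ w.1 1 0 = -star (w.1 0 1) := by
  have hdet : w.1.det = 1 := (Matrix.mem_specialUnitaryGroup_iff.1 w.2).2
  have h1 : w.1 * star w.1 = 1 :=
    Matrix.mem_unitaryGroup_iff.1 (Matrix.mem_specialUnitaryGroup_iff.1 w.2).1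
  have h2 : w.1.adjugate = star w.1 := by
    have h3 : w.1.adjugate * w.1 = 1 := by rw [Matrix.adjugate_mul, hdet, one_smul]
    exact left_inv_eq_right_inv h3 h1
  rw [Matrix.adjugate_fin_two] at h2
  have e0 := congrFun (congrFun h2 0) 0
  have e1 := congrFun (congrFun h2 1) 0
  simp only [Matrix.star_apply] at e0 e1
  exact ⟨e0, by simpa using congrArg Neg.neg e1⟩

theorem action_ketPsi (θ : ℝ) (w : SU2) (a : Fin 2) (i : Fin 4) :
    action θ w (ketPsi θ a i) = ∑ b, w.1 b a • ketPsi θ b i := by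
  obtain ⟨h1, h2⟩ := SU2_apply_one_one w
  rw [Fin.sum_univ_two]
  fin_cases a <;> fin_cases i <;>
    simp [ketPsi, action_z, action_zb, Fin.sum_univ_four, blockMatrix, h1, h2, add_comm]

/-- The invariants `ψ_{1,i} ψ_{2,j} - ψ_{2,i} ψ_{1,j}` of two components of the kets lie in
`A(S_θ^4)`: up to phases they are `0`, `(1 ± x) / 2`, `α / 2`, `β / 2` and their adjoints. -/
theorem exists_hopf_eq_minor (θ : ℝ) (i j : Fin 4) : ∃ b : A4 θ,
    hopf θ b = ketPsi θ 0 i * ketPsi θ 1 j - ketPsi θ 1 i * ketPsi θ 0 j := by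
  have hs := OddSphere.sphere (theta7 θ)
  rw [Fin.sum_univ_four] at hs
  change z θ 0 * zb θ 0 + z θ 1 * zb θ 1 + z θ 2 * zb θ 2 + z θ 3 * zb θ 3 = 1 at hs
  have ha : hopf θ (EvenSphere.gen _ (.z 0)) = alpha θ := hopf_gen θ _
  have ha' : hopf θ (EvenSphere.gen _ (.zb 0)) = star (alpha θ) := hopf_gen θ _
  have hb : hopf θ (EvenSphere.gen _ (.z 1)) = beta θ := hopf_gen θ _
  have hb' : hopf θ (EvenSphere.gen _ (.zb 1)) = star (beta θ) := hopf_gen θ _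
  have hx : hopf θ (EvenSphere.gen _ .x) = xx θ := hopf_gen θ _
  have hk := hasDegree_ketPsi θ
  -- exchanging `i` and `j` multiplies the minor by a phase
  have symm : ∀ i j : Fin 4, (∃ b : A4 θ,
      hopf θ b = ketPsi θ 0 i * ketPsi θ 1 j - ketPsi θ 1 i * ketPsi θ 0 j) → ∃ b : A4 θ,
      hopf θ b = ketPsi θ 0 j * ketPsi θ 1 i - ketPsi θ 1 j * ketPsi θ 0 i := by
    rintro i j ⟨b, hb⟩
    refine ⟨-factor θ (rowDegree j) (rowDegree i) • b, ?_⟩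
    rw [map_smul, hb, (hk 0 j).comm (hk 1 i), (hk 1 j).comm (hk 0 i)]
    module
  have diag : ∀ i : Fin 4, ∃ b : A4 θ,
      hopf θ b = ketPsi θ 0 i * ketPsi θ 1 i - ketPsi θ 1 i * ketPsi θ 0 i := fun i =>
    ⟨0, by rw [(hk 0 i).comm (hk 1 i), factor_self, one_smul, sub_self, map_zero]⟩
  have bz : ∀ i j : Fin 4, zb θ i * z θ j =
      factor θ (genDegree (.zb i)) (genDegree (.z j)) • (z θ j * zb θ i) := fun i j =>
    (hasDegree_zb θ i).comm (hasDegree_z θ j)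
  have bb : ∀ i j : Fin 4, zb θ i * zb θ j =
      factor θ (genDegree (.zb i)) (genDegree (.zb j)) • (zb θ j * zb θ i) := fun i j =>
    (hasDegree_zb θ i).comm (hasDegree_zb θ j)
  have h01 : ∃ b : A4 θ,
      hopf θ b = ketPsi θ 0 0 * ketPsi θ 1 1 - ketPsi θ 1 0 * ketPsi θ 0 1 := by
    refine ⟨(2⁻¹ : ℂ) • (1 + EvenSphere.gen _ .x), ?_⟩
    rw [map_smul, map_add, map_one, hx, xx, ← hs]
    simp [ketPsi]
    module
  have h02 : ∃ b : A4 θ,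
      hopf θ b = ketPsi θ 0 0 * ketPsi θ 1 2 - ketPsi θ 1 0 * ketPsi θ 0 2 := by
    refine ⟨-(2⁻¹ : ℂ) • EvenSphere.gen _ (.z 1), ?_⟩
    rw [map_smul, hb, beta, two_mul]
    simp [ketPsi]
    module
  have h03 : ∃ b : A4 θ,
      hopf θ b = ketPsi θ 0 0 * ketPsi θ 1 3 - ketPsi θ 1 0 * ketPsi θ 0 3 := by
    refine ⟨(2⁻¹ : ℂ) • EvenSphere.gen _ (.z 0), ?_⟩
    rw [map_smul, ha, alpha, two_mul]
    simp [ketPsi]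
    module
  have h12 : ∃ b : A4 θ,
      hopf θ b = ketPsi θ 0 1 * ketPsi θ 1 2 - ketPsi θ 1 1 * ketPsi θ 0 2 := by
    refine ⟨-(factor θ (-1, 0) (0, 1) * 2⁻¹) • EvenSphere.gen _ (.zb 0), ?_⟩
    rw [map_smul, ha', star_alpha, two_mul]
    simp [ketPsi, bz 1 3, bz 0 2, genDegree]
    module
  have h13 : ∃ b : A4 θ,
      hopf θ b = ketPsi θ 0 1 * ketPsi θ 1 3 - ketPsi θ 1 1 * ketPsi θ 0 3 := by
    refine ⟨-(factor θ (-1, 0) (0, -1) * 2⁻¹) • EvenSphere.gen _ (.zb 1), ?_⟩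
    rw [map_smul, hb', star_beta, two_mul]
    simp [ketPsi, bb 1 2, bb 0 3, genDegree]
    module
  have h23 : ∃ b : A4 θ,
      hopf θ b = ketPsi θ 0 2 * ketPsi θ 1 3 - ketPsi θ 1 2 * ketPsi θ 0 3 := by
    refine ⟨(2⁻¹ : ℂ) • (1 - EvenSphere.gen _ .x), ?_⟩
    rw [map_smul, map_sub, map_one, hx, xx, ← hs]
    simp [ketPsi]
    module
  fin_cases i <;> fin_cases j
  exacts [diag 0, h01, h02, h03, symm _ _ h01, diag 1, h12, h13, symm _ _ h02, symm _ _ h12,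
    diag 2, h23, symm _ _ h03, symm _ _ h13, symm _ _ h23, diag 3]

/-! ### Straightening words in the kets -/

/-- The product `ψ_{a_1, i_1} ⋯ ψ_{a_n, i_n}`, for letters and indices given by lists. -/
def ketWord (θ : ℝ) (a : List (Fin 2)) (i : List (Fin 4)) : A7 θ :=
  (List.zipWith (ketPsi θ) a i).prod

theorem ketWord_cons (θ : ℝ) (a : Fin 2) (as : List (Fin 2)) (i : Fin 4) (is : List (Fin 4)) :
    ketWord θ (a :: as) (i :: is) = ketPsi θ a i * ketWord θ as is := by
  simp [ketWord]

theorem ketTensor_eq_ketWord (n : ℕ) (θ : ℝ) (a : Fin n → Fin 2) (i : Fin n → Fin 4) :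
    ketTensor n θ a i = ketWord θ (List.ofFn a) (List.ofFn i) := by
  rw [ketTensor, ketWord]
  congr 1
  refine List.ext_getElem (by simp) fun k h1 h2 => ?_
  simp

theorem exists_hasDegree_ketWord (θ : ℝ) (as : List (Fin 2)) (is : List (Fin 4))
    (h : as ≠ []) (h' : is ≠ []) : ∃ d, HasDegree θ d (ketWord θ as is) := by
  induction as generalizing is with
  | nil => exact absurd rfl h
  | cons a as ih =>
    obtain ⟨i, is, rfl⟩ := List.exists_cons_of_ne_nil h'
    rw [ketWord_cons]
    rcases eq_or_ne as [] with rfl | h1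
    · exact ⟨_, by simpa [ketWord] using hasDegree_ketPsi θ a i⟩
    rcases eq_or_ne is [] with rfl | h2
    · exact ⟨_, by simpa [ketWord] using hasDegree_ketPsi θ a i⟩
    · obtain ⟨d, hd⟩ := ih is h1 h2
      exact ⟨_, .mul (hasDegree_ketPsi θ a i) hd⟩

/-- The right `A(S_θ^4)`-submodule spanned by the words of length `n - 2`
(it is zero for `n < 2`). -/
def wordSpan (θ : ℝ) (n : ℕ) : Submodule (A4 θ)ᵐᵒᵖ (A7 θ) :=
  Submodule.span _ {y | ∃ as is, as.length + 2 = n ∧ is.length + 2 = n ∧ y = ketWord θ as is}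

theorem ketPsi_mul_mem_wordSpan {θ : ℝ} {n : ℕ} (a : Fin 2) (i : Fin 4) {y : A7 θ}
    (hy : y ∈ wordSpan θ n) : ketPsi θ a i * y ∈ wordSpan θ (n + 1) := by
  induction hy using Submodule.span_induction with
  | zero => simp
  | add u v _ _ hu hv => rw [mul_add]; exact Submodule.add_mem _ hu hv
  | smul c u _ hu =>
    rw [op_smul_eq, ← mul_assoc, ← op_smul_eq c]
    exact Submodule.smul_mem _ c hu
  | mem u hu =>
    obtain ⟨as, is, h1, h2, rfl⟩ := hu
    exact Submodule.subset_span ⟨a :: as, i :: is, by simp; omega, by simp; omega,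
      (ketWord_cons θ a as i is).symm⟩

/-- Permuting the letters of a word changes it by combinations of words that are two letters
shorter: transposing neighbouring letters changes the word by a factor in `A(S_θ^4)`, which can be
moved to the right. -/
theorem ketWord_sub_mem_wordSpan (θ : ℝ) {as bs : List (Fin 2)} (h : as.Perm bs) :
    ∀ is : List (Fin 4), is.length = as.length →
      ketWord θ as is - ketWord θ bs is ∈ wordSpan θ as.length := by
  induction h with
  | nil => intro is _; simp
  | cons a h ih =>
    intro is his
    obtain ⟨i, is, rfl⟩ := List.exists_cons_of_length_eq_add_one his
    rw [ketWord_cons, ketWord_cons, ← mul_sub]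
    exact ketPsi_mul_mem_wordSpan a i (ih is (by simpa using his))
  | trans h1 _ ih1 ih2 =>
    intro is his
    rw [← sub_add_sub_cancel]
    refine Submodule.add_mem _ (ih1 is his) ?_
    rw [h1.length_eq]
    exact ih2 is (his.trans h1.length_eq)
  | swap a b as =>
    intro is his
    obtain ⟨i, is, rfl⟩ := List.exists_cons_of_length_eq_add_one his
    obtain ⟨j, is, rfl⟩ := List.exists_cons_of_length_eq_add_one (by simpa using his)
    have hlen : is.length = as.length := by simpa using his
    simp only [ketWord_cons, ← mul_assoc, ← sub_mul]
    have key : ∃ c : A4 θ, ketPsi θ b i * ketPsi θ a j - ketPsi θ a i * ketPsi θ b j =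
        hopf θ c := by
      obtain ⟨c, hc⟩ := exists_hopf_eq_minor θ i j
      fin_cases a <;> fin_cases b
      · exact ⟨0, by simp⟩
      · exact ⟨-c, by rw [map_neg, hc]; simp⟩
      · exact ⟨c, by rw [hc]; simp⟩
      · exact ⟨0, by simp⟩
    obtain ⟨c, hc⟩ := key
    have hw : ketWord θ as is ∈ wordSpan θ (b :: a :: as).length :=
      Submodule.subset_span ⟨as, is, by simp, by simp [hlen], rfl⟩
    have hmem := Submodule.smul_mem _ (MulOpposite.op c) hw
    rw [op_smul_eq, MulOpposite.unop_op] at hmem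
    rcases eq_or_ne as [] with rfl | has
    · obtain rfl : is = [] := by simpa using hlen
      rw [hc]
      simpa [ketWord] using hmem
    · obtain ⟨d, hd⟩ := exists_hasDegree_ketWord θ as is has (by
        rintro rfl
        exact has (List.length_eq_zero_iff.1 hlen.symm))
      have hm : HasDegree θ (rowDegree i + rowDegree j)
          (ketPsi θ b i * ketPsi θ a j - ketPsi θ a i * ketPsi θ b j) := by
        rw [sub_eq_add_neg]
        exact .add (.mul (hasDegree_ketPsi θ _ _) (hasDegree_ketPsi θ _ _))
          (.neg (.mul (hasDegree_ketPsi θ _ _) (hasDegree_ketPsi θ _ _)))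
      rw [hm.comm hd, hc, ← mul_smul_comm, ← map_smul]
      have := Submodule.smul_mem _ (MulOpposite.op (factor θ (rowDegree i + rowDegree j) d • c)) hw
      rwa [op_smul_eq, MulOpposite.unop_op] at this

/-- The product `ψ(v)_{i_1} ⋯ ψ(v)_{i_n}`, where `ψ(v) = v_1 ψ_1 + v_2 ψ_2`. -/
def ketPower (θ : ℝ) (n : ℕ) (i : Fin n → Fin 4) (v : Fin 2 → ℂ) : A7 θ :=
  (List.ofFn fun j => ∑ a, v a • ketPsi θ a (i j)).prod

theorem ketPower_eq_sum (θ : ℝ) (n : ℕ) (i : Fin n → Fin 4) (v : Fin 2 → ℂ) :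
    ketPower θ n i v = ∑ a : Fin n → Fin 2, (∏ j, v (a j)) • ketTensor n θ a i := by
  have h := MultilinearMap.map_sum (MultilinearMap.mkPiAlgebraFin ℂ n (A7 θ))
    fun j (a : Fin 2) => v a • ketPsi θ a (i j)
  simp only [MultilinearMap.mkPiAlgebraFin_apply, MultilinearMap.map_smul_univ] at h
  exact h

/-- The coefficients of a polynomial function with values in a submodule lie in the submodule. -/
theorem mem_of_forall_sum_pow_smul_mem {E : Type} [AddCommGroup E] [Module ℂ E]
    (N : Submodule ℂ E) {n : ℕ} (y : Fin n → E) (h : ∀ t : ℂ, ∑ k : Fin n, t ^ (k : ℕ) • y k ∈ N)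
    (k : Fin n) : y k ∈ N := by
  rw [← Submodule.Quotient.mk_eq_zero, ← Module.forall_dual_apply_eq_zero_iff ℂ]
  intro f
  have hp : ∑ k : Fin n, Polynomial.C (f (N.mkQ (y k))) * Polynomial.X ^ (k : ℕ) = 0 := by
    refine Polynomial.funext fun t => ?_
    have := congrArg f ((Submodule.Quotient.mk_eq_zero N).2 (h t))
    rw [← Submodule.mkQ_apply, map_zero] at this
    simp only [map_sum, map_smul, smul_eq_mul] at this
    rw [Polynomial.eval_finsetSum, Polynomial.eval_zero, ← this]
    exact Finset.sum_congr rfl fun k _ => by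
      rw [Polynomial.eval_C_mul, Polynomial.eval_X_pow, mul_comm]
  have := congrArg (fun p => p.coeff (k : ℕ)) hp
  simpa [Polynomial.finsetSum_coeff, Polynomial.coeff_X_pow, Fin.val_inj] using this

theorem card_words (n : ℕ) (k : Fin (n + 1)) : (words n k).card = n.choose k := by
  have h := Finset.card_powersetCard (k : ℕ) (Finset.univ : Finset (Fin n))
  rw [Finset.card_univ, Fintype.card_fin] at h
  rw [← h]
  refine Finset.card_nbij' (fun a => Finset.univ.filter fun j => a j = 1)
    (fun s j => if j ∈ s then 1 else 0) ?_ ?_ ?_ ?_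
  · intro a ha
    simpa [words, Finset.mem_powersetCard] using ha
  · intro s hs
    simpa [words, Finset.mem_powersetCard] using hs
  · intro a _
    funext j
    simp only [Finset.mem_filter, Finset.mem_univ, true_and]
    split_ifs with h
    · exact h.symm
    · omega
  · intro s _
    ext j
    simp

theorem sum_sum_words {E : Type} [AddCommMonoid E] (n : ℕ) (f : (Fin n → Fin 2) → E) :
    ∑ k, ∑ a ∈ words n k, f a = ∑ a, f a := by
  let c : (Fin n → Fin 2) → Fin (n + 1) := fun a =>
    ⟨(Finset.univ.filter fun j => a j = 1).card,
      Nat.lt_succ_of_le ((Finset.card_le_univ _).trans_eq (Fintype.card_fin n))⟩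
  rw [← Finset.sum_fiberwise Finset.univ c f]
  refine Finset.sum_congr rfl fun k _ => Finset.sum_congr ?_ fun _ _ => rfl
  ext a
  simp [words, c, Fin.ext_iff]

/-- Words with the same number of letters of each kind differ by a permutation of the places. -/
theorem exists_perm_of_mem_words {n : ℕ} {k : Fin (n + 1)} {a b : Fin n → Fin 2}
    (ha : a ∈ words n k) (hb : b ∈ words n k) : ∃ σ : Equiv.Perm (Fin n), b ∘ σ = a := by
  have hone : ∀ c ∈ words n k, Fintype.card {j // c j = 1} = k := by
    intro c hc
    rw [Fintype.card_subtype, (Finset.mem_filter.1 hc).2]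
  have hzero : ∀ c ∈ words n k, Fintype.card {j // c j = 0} = n - k := by
    intro c hc
    have h : (Finset.univ.filter fun j => c j = 1).card +
        (Finset.univ.filter fun j => ¬ c j = 1).card = n := by
      rw [Finset.card_filter_add_card_filter_not, Finset.card_univ, Fintype.card_fin]
    rw [(Finset.mem_filter.1 hc).2] at h
    have h' : ∀ j, ¬ c j = 1 ↔ c j = 0 := fun j => by omega
    simp only [h'] at h
    rw [Fintype.card_subtype]
    exact Nat.eq_sub_of_add_eq' h
  have hcard : ∀ x, Fintype.card {j // a j = x} = Fintype.card {j // b j = x} := by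
    intro x
    fin_cases x
    · exact (hzero a ha).trans (hzero b hb).symm
    · exact (hone a ha).trans (hone b hb).symm
  exact ⟨Equiv.ofFiberEquiv fun x => Fintype.equivOfCardEq (hcard x),
    funext fun j => Equiv.ofFiberEquiv_map _ j⟩

theorem exists_mem_words {n : ℕ} (a : Fin n → Fin 2) : ∃ k, a ∈ words n k := by
  refine ⟨⟨(Finset.univ.filter fun j => a j = 1).card,
    Nat.lt_succ_of_le ((Finset.card_le_univ _).trans_eq (Fintype.card_fin n))⟩, ?_⟩
  simp [words]

instance (θ : ℝ) : IsScalarTower ℂ (A4 θ)ᵐᵒᵖ (A7 θ) :=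
  ⟨fun c a b => by
    rw [op_smul_eq, op_smul_eq, MulOpposite.unop_smul, map_smul, mul_smul_comm]⟩

/-- A subspace of `A(S_Θ^{2n-1})` that contains `1` and is stable under left multiplication by the
generators is everything. -/
theorem OddSphere.eq_top_of_mul_mem {n : ℕ} {Θ : Matrix (Fin n) (Fin n) ℝ}
    (N : Submodule ℂ (OddSphere Θ)) (h1 : 1 ∈ N)
    (hN : ∀ g, ∀ a ∈ N, OddSphere.gen Θ g * a ∈ N) : N = ⊤ := by
  have key : ∀ (p : FreeAlgebra ℂ (EvenGen n)), ∀ a ∈ N, OddSphere.mk Θ p * a ∈ N := by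
    intro p
    induction p using FreeAlgebra.induction with
    | grade0 r =>
      intro a ha
      rw [AlgHom.commutes, ← Algebra.smul_def]
      exact N.smul_mem r ha
    | grade1 g => exact hN g
    | mul p q hp hq =>
      intro a ha
      rw [map_mul, mul_assoc]
      exact hp _ (hq _ ha)
    | add p q hp hq =>
      intro a ha
      rw [map_add, add_mul]
      exact N.add_mem (hp _ ha) (hq _ ha)
  rw [eq_top_iff]
  intro a _
  obtain ⟨p, rfl⟩ := RingQuot.mkAlgHom_surjective ℂ (OddSphereRel Θ) a
  have h := key p 1 h1
  rw [mul_one] at h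
  exact h

theorem span_ketWord (θ : ℝ) :
    Submodule.span ℂ {y : A7 θ | ∃ as is, as.length = is.length ∧ y = ketWord θ as is} = ⊤ := by
  refine OddSphere.eq_top_of_mul_mem _ (Submodule.subset_span ⟨[], [], rfl, rfl⟩) ?_
  intro g y hy
  induction hy using Submodule.span_induction with
  | zero => simp
  | add u v _ _ hu hv => rw [mul_add]; exact Submodule.add_mem _ hu hv
  | smul c u _ hu => rw [mul_smul_comm]; exact Submodule.smul_mem _ c hu
  | mem u hu =>
    obtain ⟨as, is, h, rfl⟩ := hu
    have hg : ∃ (a : Fin 2) (i : Fin 4) (c : ℂ), OddSphere.gen (theta7 θ) g = c • ketPsi θ a i := by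
      rcases g with i | i <;> fin_cases i
      · exact ⟨0, 0, 1, (one_smul ℂ _).symm⟩
      · exact ⟨1, 0, 1, (one_smul ℂ _).symm⟩
      · exact ⟨0, 2, 1, (one_smul ℂ _).symm⟩
      · exact ⟨1, 2, 1, (one_smul ℂ _).symm⟩
      · exact ⟨1, 1, 1, (one_smul ℂ _).symm⟩
      · exact ⟨0, 1, -1, by rw [neg_smul, one_smul]; exact (neg_neg (zb θ 1)).symm⟩
      · exact ⟨1, 3, 1, (one_smul ℂ _).symm⟩
      · exact ⟨0, 3, -1, by rw [neg_smul, one_smul]; exact (neg_neg (zb θ 3)).symm⟩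
    obtain ⟨a, i, c, hg⟩ := hg
    rw [hg, smul_mul_assoc, ← ketWord_cons]
    exact Submodule.smul_mem _ c
      (Submodule.subset_span ⟨a :: as, i :: is, by simp [h], rfl⟩)

/-- The algebra `A(S_θ'^7)` is generated, as a right module over `A(S_θ^4)`, by the products
`ψ(v)_{i_1} ⋯ ψ(v)_{i_n}`: by polarization these span the sums of words over all orders of the
letters, and modulo shorter words each word is the average of such a sum. -/
theorem span_ketPower (θ : ℝ) : Submodule.span (A4 θ)ᵐᵒᵖ
    {y : A7 θ | ∃ n i v, y = ketPower θ n i v} = ⊤ := by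
  set N := Submodule.span (A4 θ)ᵐᵒᵖ {y : A7 θ | ∃ n i v, y = ketPower θ n i v} with hN
  have hword : ∀ n : ℕ, ∀ as is, as.length = n → is.length = n → ketWord θ as is ∈ N := by
    intro n
    induction n using Nat.strong_induction_on with
    | _ n ih =>
    intro as is has his
    obtain ⟨a, rfl⟩ : ∃ a : Fin n → Fin 2, as = List.ofFn a := by
      subst has
      exact ⟨as.get, (List.ofFn_get as).symm⟩
    obtain ⟨i, rfl⟩ : ∃ i : Fin n → Fin 4, is = List.ofFn i := by
      subst his
      exact ⟨is.get, (List.ofFn_get is).symm⟩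
    have hle : wordSpan θ n ≤ N := by
      refine Submodule.span_le.2 ?_
      rintro _ ⟨as', is', h1, h2, rfl⟩
      exact ih as'.length (by omega) as' is' rfl (by omega)
    -- these sums are the coefficients of `t ^ k` in `ψ(1, t)_{i_1} ⋯ ψ(1, t)_{i_n}`
    have hsym : ∀ k : Fin (n + 1), ∑ b ∈ words n k, ketTensor n θ b i ∈ N := by
      refine mem_of_forall_sum_pow_smul_mem (N.restrictScalars ℂ) _ fun t => ?_
      have e : ∑ k : Fin (n + 1), t ^ (k : ℕ) • ∑ b ∈ words n k, ketTensor n θ b i =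
          ketPower θ n i ![1, t] := by
        rw [ketPower_eq_sum, ← sum_sum_words]
        refine Finset.sum_congr rfl fun k _ => ?_
        rw [Finset.smul_sum]
        refine Finset.sum_congr rfl fun b hb => ?_
        congr 1
        have h : ∀ c : Fin 2, (![1, t] : Fin 2 → ℂ) c = if c = 1 then t else 1 := by
          intro c; fin_cases c <;> rfl
        simp only [h, Finset.prod_ite, Finset.prod_const, one_pow, mul_one]
        rw [(Finset.mem_filter.1 hb).2]
      rw [e]
      exact Submodule.subset_span ⟨n, i, _, rfl⟩
    obtain ⟨k, hk⟩ := exists_mem_words a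
    have hdiff : ∑ b ∈ words n k, (ketTensor n θ a i - ketTensor n θ b i) ∈ N := by
      refine Submodule.sum_mem _ fun b hb => hle ?_
      obtain ⟨σ, rfl⟩ := exists_perm_of_mem_words hk hb
      have := ketWord_sub_mem_wordSpan θ (σ.ofFn_comp_perm b) (List.ofFn i) (by simp)
      rw [List.length_ofFn] at this
      rwa [ketTensor_eq_ketWord, ketTensor_eq_ketWord]
    have hcard := Submodule.add_mem _ hdiff (hsym k)
    rw [Finset.sum_sub_distrib, sub_add_cancel, Finset.sum_const, ← Nat.cast_smul_eq_nsmul ℂ]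
      at hcard
    have hne : ((words n k).card : ℂ) ≠ 0 := Nat.cast_ne_zero.2 (Finset.card_ne_zero_of_mem hk)
    have := (N.restrictScalars ℂ).smul_mem ((words n k).card : ℂ)⁻¹ hcard
    rwa [smul_smul, inv_mul_cancel₀ hne, one_smul, ketTensor_eq_ketWord] at this
  rw [eq_top_iff]
  intro y _
  have hy : y ∈ Submodule.span ℂ
      {y : A7 θ | ∃ as is, as.length = is.length ∧ y = ketWord θ as is} :=
    span_ketWord θ ▸ Submodule.mem_top
  refine (Submodule.span_le (p := N.restrictScalars ℂ)).2 ?_ hy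
  rintro _ ⟨as, is, h, rfl⟩
  exact hword as.length as is rfl h.symm

/-! ### Invariants of `SU(2)` by averaging -/

instance : IsTopologicalGroup SU2 where
  continuous_mul := Continuous.subtype_mk
    ((continuous_subtype_val.comp continuous_fst).mul
      (continuous_subtype_val.comp continuous_snd)) _
  continuous_inv := Continuous.subtype_mk continuous_subtype_val.star _

instance : CompactSpace SU2 := by
  refine isCompact_iff_compactSpace.1
    (?_ : IsCompact (Matrix.specialUnitaryGroup (Fin 2) ℂ : Set (Matrix (Fin 2) (Fin 2) ℂ)))
  have hK := isCompact_univ_pi (X := fun _ : Fin 2 => Fin 2 → ℂ) (s := fun _ =>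
    Set.univ.pi fun _ => Metric.closedBall (0 : ℂ) 1) fun _ =>
      isCompact_univ_pi fun _ => isCompact_closedBall _ _
  refine IsCompact.of_isClosed_subset (X := Matrix (Fin 2) (Fin 2) ℂ) hK ?_ ?_
  · have e : ((Matrix.specialUnitaryGroup (Fin 2) ℂ : Set (Matrix (Fin 2) (Fin 2) ℂ))) =
        {M | M * star M = 1} ∩ {M | M.det = 1} := by
      ext M
      simp only [SetLike.mem_coe, Matrix.mem_specialUnitaryGroup_iff, Matrix.mem_unitaryGroup_iff]
      rfl
    rw [e]
    exact (isClosed_eq (continuous_id.mul continuous_star) continuous_const).inter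
      (isClosed_eq continuous_id.matrix_det continuous_const)
  · intro M hM
    refine Set.mem_univ_pi.2 fun i => Set.mem_univ_pi.2 fun j => ?_
    rw [mem_closedBall_zero_iff]
    exact entry_norm_bound_of_unitary (Matrix.mem_specialUnitaryGroup_iff.1 hM).1 i j

/-- Every vector of `ℂ²` is an eigenvector of some element of `SU(2)`, with any given eigenvalue of
modulus one. -/
theorem exists_SU2_mulVec_eq (v : Fin 2 → ℂ) (ζ : ℂ) (hζ : ζ * starRingEnd ℂ ζ = 1) :
    ∃ w : SU2, w.1 *ᵥ v = ζ • v := by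
  by_cases hv : v = 0
  · exact ⟨1, by simp [hv]⟩
  set N : ℂ := v 0 * starRingEnd ℂ (v 0) + v 1 * starRingEnd ℂ (v 1) with hN
  have hN0 : N ≠ 0 := by
    intro h
    apply hv
    have h2 : ‖v 0‖ ^ 2 + ‖v 1‖ ^ 2 = 0 := by
      have : ((‖v 0‖ ^ 2 + ‖v 1‖ ^ 2 : ℝ) : ℂ) = N := by
        rw [hN]
        simp [Complex.mul_conj, Complex.normSq_eq_norm_sq]
      rw [h] at this
      exact_mod_cast this
    have h0 : ‖v 0‖ = 0 := by nlinarith [sq_nonneg ‖v 0‖, sq_nonneg ‖v 1‖]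
    have h1 : ‖v 1‖ = 0 := by nlinarith [sq_nonneg ‖v 0‖, sq_nonneg ‖v 1‖]
    ext i
    fin_cases i
    · exact norm_eq_zero.1 h0
    · exact norm_eq_zero.1 h1
  have hNs : starRingEnd ℂ N = N := by rw [hN]; simp [mul_comm]
  -- `ζ P + ζ⁻¹ (1 - P)`, where `P` is the orthogonal projection onto the line of `v`
  let w : Matrix (Fin 2) (Fin 2) ℂ :=
    !![(ζ * (v 0 * starRingEnd ℂ (v 0)) + starRingEnd ℂ ζ * (v 1 * starRingEnd ℂ (v 1))) / N,
       (ζ - starRingEnd ℂ ζ) * (v 0 * starRingEnd ℂ (v 1)) / N;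
       (ζ - starRingEnd ℂ ζ) * (v 1 * starRingEnd ℂ (v 0)) / N,
       (ζ * (v 1 * starRingEnd ℂ (v 1)) + starRingEnd ℂ ζ * (v 0 * starRingEnd ℂ (v 0))) / N]
  have hdet : w.det = 1 := by
    rw [Matrix.det_fin_two_of]
    field_simp
    rw [hN]
    linear_combination (v 0 * starRingEnd ℂ (v 0) + v 1 * starRingEnd ℂ (v 1)) ^ 2 * hζ
  have hstar : w * star w = 1 := by
    rw [Matrix.star_eq_conjTranspose]
    -- a matrix of determinant one is unitary if its adjoint is its adjugate
    have hadj : wᴴ = w.adjugate := by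
      rw [Matrix.adjugate_fin_two]
      ext i j
      fin_cases i <;> fin_cases j <;> simp [w] <;> rw [hNs] <;> ring
    rw [hadj, Matrix.mul_adjugate, hdet, one_smul]
  refine ⟨⟨w, Matrix.mem_specialUnitaryGroup_iff.2
    ⟨Matrix.mem_unitaryGroup_iff.2 hstar, hdet⟩⟩, ?_⟩
  ext i
  fin_cases i
  · simp [w, Matrix.mulVec, dotProduct]
    field_simp
    rw [hN]
    ring
  · simp [w, Matrix.mulVec, dotProduct]
    field_simp
    rw [hN]
    ring

theorem action_ketPower (θ : ℝ) (w : SU2) (n : ℕ) (i : Fin n → Fin 4) (v : Fin 2 → ℂ) :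
    action θ w (ketPower θ n i v) = ketPower θ n i (w.1 *ᵥ v) := by
  rw [ketPower, ketPower, map_list_prod, List.map_ofFn]
  congr 2
  funext j
  simp only [Function.comp, map_add, map_smul, action_ketPsi, Fin.sum_univ_two, Matrix.mulVec,
    dotProduct]
  module

theorem ketPower_smul (θ : ℝ) (n : ℕ) (i : Fin n → Fin 4) (c : ℂ) (v : Fin 2 → ℂ) :
    ketPower θ n i (c • v) = c ^ n • ketPower θ n i v := by
  rw [ketPower_eq_sum, ketPower_eq_sum, Finset.smul_sum]
  refine Finset.sum_congr rfl fun a _ => ?_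
  simp [Finset.prod_mul_distrib, smul_smul]

section Average

open MeasureTheory

instance : MeasurableSpace SU2 := borel SU2

instance : BorelSpace SU2 := ⟨rfl⟩

/-- The Haar probability measure of `SU(2)`. -/
def haarSU2 : Measure SU2 := Measure.haarMeasure ⊤

instance : haarSU2.IsMulLeftInvariant := inferInstanceAs (Measure.haarMeasure ⊤).IsMulLeftInvariant

instance : IsProbabilityMeasure haarSU2 := ⟨Measure.haarMeasure_self⟩

/-- The element `b` of `A(S_θ^4)` is the average of `y` over `SU(2)`, in the weak sense. -/
def IsAverage (θ : ℝ) (y : A7 θ) (b : A4 θ) : Prop :=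
  ∀ f : A7 θ →ₗ[ℂ] ℂ, Continuous (fun w : SU2 => f (action θ w⁻¹ y)) ∧
    ∫ w, f (action θ w⁻¹ y) ∂haarSU2 = f (hopf θ b)

/-- An invariant element is its own average, because linear functionals separate points. -/
theorem IsAverage.hopf_eq {θ : ℝ} {y : A7 θ} {b : A4 θ} (h : IsAverage θ y b)
    (hy : ∀ w, action θ w y = y) : hopf θ b = y := by
  rw [← sub_eq_zero, ← Module.forall_dual_apply_eq_zero_iff ℂ]
  intro f
  have := (h f).2
  simp only [hy, integral_const, probReal_univ, one_smul] at this
  rw [map_sub, this, sub_self]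

/-- The average of `ψ(v)_{i_1} ⋯ ψ(v)_{i_n}` vanishes for `n > 0`: it does not change when `v` is
replaced by `w v`, and some `w` multiplies `v` by a number whose `n`-th power is `-1`. -/
theorem isAverage_ketPower_zero (θ : ℝ) {n : ℕ} (hn : n ≠ 0) (i : Fin n → Fin 4) (v : Fin 2 → ℂ) :
    IsAverage θ (ketPower θ n i v) 0 := by
  intro f
  refine ⟨?_, ?_⟩
  · simp only [action_ketPower]
    simp only [ketPower_eq_sum, map_sum, map_smul, smul_eq_mul]
    refine continuous_finsetSum _ fun a _ => Continuous.mul ?_ continuous_const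
    refine continuous_finsetProd _ fun j _ => ?_
    have h : Continuous fun w : SU2 => w⁻¹.1 *ᵥ v :=
      (continuous_subtype_val.comp continuous_inv).matrix_mulVec continuous_const
    exact (continuous_apply (a j)).comp h
  · set ζ : ℂ := Complex.exp (Real.pi * Complex.I / n) with hζ
    have hn' : (n : ℂ) ≠ 0 := Nat.cast_ne_zero.2 hn
    have hpow : ζ ^ n = -1 := by
      rw [hζ, ← Complex.exp_nat_mul, mul_div_cancel₀ _ hn', Complex.exp_pi_mul_I]
    have hunit : ζ * starRingEnd ℂ ζ = 1 := by
      rw [hζ, ← Complex.exp_conj, ← Complex.exp_add, ← Complex.exp_zero]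
      congr 1
      simp
      ring
    obtain ⟨g, hg⟩ := exists_SU2_mulVec_eq v ζ hunit
    have h := integral_mul_left_eq_self (μ := haarSU2)
      (fun w : SU2 => f (action θ w⁻¹ (ketPower θ n i v))) g⁻¹
    have e : ∀ w : SU2, f (action θ (g⁻¹ * w)⁻¹ (ketPower θ n i v)) =
        -f (action θ w⁻¹ (ketPower θ n i v)) := by
      intro w
      rw [mul_inv_rev, inv_inv, action_ketPower, action_ketPower]
      change f (ketPower θ n i ((w⁻¹.1 * g.1) *ᵥ v)) = _
      rw [← Matrix.mulVec_mulVec, hg, Matrix.mulVec_smul, ketPower_smul, hpow, neg_one_smul,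
        map_neg]
    simp only [e, integral_neg] at h
    rw [map_zero, map_zero]
    linear_combination -h / 2

/-- Every element has an average in `A(S_θ^4)`: averaging is linear over `A(S_θ^4)`, so the
generators `ψ(v)_{i_1} ⋯ ψ(v)_{i_n}` suffice. -/
theorem exists_isAverage (θ : ℝ) (y : A7 θ) : ∃ b, IsAverage θ y b := by
  have hy : y ∈ Submodule.span (A4 θ)ᵐᵒᵖ {y : A7 θ | ∃ n i v, y = ketPower θ n i v} :=
    span_ketPower θ ▸ Submodule.mem_top
  induction hy using Submodule.span_induction with
  | zero => exact ⟨0, fun f => by simp [continuous_const]⟩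
  | add u u' _ _ hu hu' =>
    obtain ⟨b, hb⟩ := hu
    obtain ⟨b', hb'⟩ := hu'
    refine ⟨b + b', fun f => ?_⟩
    have hi : ∀ {g : SU2 → ℂ}, Continuous g → Integrable g haarSU2 := fun hg =>
      hg.integrable_of_hasCompactSupport (HasCompactSupport.of_compactSpace _)
    simp only [map_add]
    exact ⟨(hb f).1.add (hb' f).1, by
      rw [integral_add (hi (hb f).1) (hi (hb' f).1), (hb f).2, (hb' f).2]⟩
  | smul c u _ hu =>
    obtain ⟨b, hb⟩ := hu
    refine ⟨b * c.unop, fun f => ?_⟩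
    have := hb (f ∘ₗ LinearMap.mulRight ℂ (hopf θ c.unop))
    simpa [op_smul_eq, action_hopf] using this
  | mem u hu =>
    obtain ⟨n, i, v, rfl⟩ := hu
    rcases eq_or_ne n 0 with rfl | hn
    · refine ⟨1, fun f => ?_⟩
      simp [ketPower, continuous_const]
    · exact ⟨0, isAverage_ketPower_zero θ hn i v⟩

end Average

/-- The invariants of `SU(2)` in `A(S_θ'^7)` are the elements of `A(S_θ^4)`. -/
theorem exists_hopf_eq_of_invariant {θ : ℝ} {y : A7 θ} (hy : ∀ w, action θ w y = y) :
    ∃ b, hopf θ b = y := by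
  obtain ⟨b, hb⟩ := exists_isAverage θ y
  exact ⟨b, hb.hopf_eq hy⟩

/-! ### The inclusion and the involutions -/

theorem hopf_star (θ : ℝ) (a : A4 θ) : hopf θ (star a) = star (hopf θ a) := by
  let F : A4 θ →ₐ[ℂ] A7 θ :=
    AlgHom.ofLinearMap
      { toFun := fun a => star (hopf θ (star a))
        map_add' := fun a b => by simp
        map_smul' := fun c a => by simp }
      (by simp) (fun a b => by simp)
  have hF : F = hopf θ := by
    apply EvenSphere.hom_ext
    intro g
    change star (hopf θ (ofConj (EvenSphere.conj Fact.out (EvenSphere.gen (theta4 θ) g)))) =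
      hopf θ (EvenSphere.gen _ g)
    rcases g with i | i | _
    · simp only [EvenSphere.conj, EvenSphere.lift_gen, ofConj_toConj, hopf_gen]
      fin_cases i <;> exact star_star _
    · simp only [EvenSphere.conj, EvenSphere.lift_gen, ofConj_toConj, hopf_gen]
      fin_cases i <;> rfl
    · simp only [EvenSphere.conj, EvenSphere.lift_gen, ofConj_toConj, hopf_gen, hopfGen, xx,
        star_add, star_sub, star_mul, star_z, star_zb]
  have h := congrArg (fun G : A4 θ →ₐ[ℂ] A7 θ => G (star a)) hF
  change star (hopf θ (star (star a))) = hopf θ (star a) at h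
  rw [← h, star_star]

/-! ### Linear maps on symmetric powers -/

/-- The linear map on `Sym^n (M)` given by the symmetrization of a multilinear map. -/
def symLift {n : ℕ} {M E : Type} [AddCommGroup M] [Module ℂ M] [AddCommGroup E] [Module ℂ E]
    (f : MultilinearMap ℂ (fun _ : Fin n => M) E) : Sym[ℂ]^n M →ₗ[ℂ] E where
  toFun := AddCon.lift _ (PiTensorProduct.lift ((n.factorial : ℂ)⁻¹ •
      ∑ σ : Equiv.Perm (Fin n), f.domDomCongr σ)).toAddMonoidHom
    (by
      refine AddCon.addConGen_le.2 ?_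
      intro x y h
      cases h with
      | perm e v =>
        let f' : MultilinearMap ℂ (fun _ : Fin n => M) E :=
          (n.factorial : ℂ)⁻¹ • ∑ σ : Equiv.Perm (Fin n), f.domDomCongr σ
        change PiTensorProduct.lift f' (PiTensorProduct.tprod ℂ v) =
          PiTensorProduct.lift f' (PiTensorProduct.tprod ℂ fun j => v (e j))
        rw [PiTensorProduct.lift.tprod, PiTensorProduct.lift.tprod]
        simp only [f', _root_.smul_apply, _root_.sum_apply,
          MultilinearMap.domDomCongr_apply]
        congr 1
        exact (Fintype.sum_equiv (Equiv.mulLeft e) _ _ fun σ => rfl).symm)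
  map_add' := map_add _
  map_smul' c x := by
    induction x using AddCon.induction_on with
    | H t =>
      exact map_smul (PiTensorProduct.lift ((n.factorial : ℂ)⁻¹ •
        ∑ σ : Equiv.Perm (Fin n), f.domDomCongr σ)) c t

theorem symLift_tprod {n : ℕ} {M E : Type} [AddCommGroup M] [Module ℂ M] [AddCommGroup E]
    [Module ℂ E] (f : MultilinearMap ℂ (fun _ : Fin n => M) E) (v : Fin n → M) :
    symLift f (⨂ₛ[ℂ] j, v j) = (n.factorial : ℂ)⁻¹ • ∑ σ : Equiv.Perm (Fin n), f (v ∘ σ) := by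
  change PiTensorProduct.lift _ (PiTensorProduct.tprod ℂ v) = _
  rw [PiTensorProduct.lift.tprod]
  simp only [_root_.smul_apply, _root_.sum_apply, MultilinearMap.domDomCongr_apply]
  rfl

/-- The symmetric tensor `e_{a_1} ⋯ e_{a_n}`. -/
def letterVec (n : ℕ) (a : Fin n → Fin 2) : V n := ⨂ₛ[ℂ] j, (Pi.single (a j) 1 : Fin 2 → ℂ)

theorem letterVec_eq_of_mem_words {n : ℕ} {k : Fin (n + 1)} {a b : Fin n → Fin 2}
    (ha : a ∈ words n k) (hb : b ∈ words n k) : letterVec n a = letterVec n b := by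
  obtain ⟨σ, rfl⟩ := exists_perm_of_mem_words ha hb
  exact SymmetricPower.tprod_equiv σ fun j => (Pi.single (b j) 1 : Fin 2 → ℂ)

theorem normConst_mul_self (n : ℕ) (k : Fin (n + 1)) :
    normConst n k * normConst n k = (words n k).card := by
  rw [normConst, ← Complex.ofReal_mul, Real.mul_self_sqrt (Nat.cast_nonneg _), card_words]
  simp

theorem card_words_ne_zero (n : ℕ) (k : Fin (n + 1)) : ((words n k).card : ℂ) ≠ 0 := by
  rw [card_words]
  exact Nat.cast_ne_zero.2 (Nat.choose_pos (Nat.le_of_lt_succ k.2)).ne'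

theorem normConst_ne_zero (n : ℕ) (k : Fin (n + 1)) : normConst n k ≠ 0 := fun h =>
  card_words_ne_zero n k (by rw [← normConst_mul_self, h, zero_mul])

theorem star_normConst (n : ℕ) (k : Fin (n + 1)) : star (normConst n k) = normConst n k :=
  Complex.conj_ofReal _

theorem basisVec_eq_smul_letterVec {n : ℕ} {k : Fin (n + 1)} {a : Fin n → Fin 2}
    (ha : a ∈ words n k) : basisVec n k = normConst n k • letterVec n a := by
  have h : ∑ b ∈ words n k, letterVec n b = ((words n k).card : ℂ) • letterVec n a := by
    rw [Finset.sum_congr rfl fun b hb => letterVec_eq_of_mem_words hb ha, Finset.sum_const,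
      Nat.cast_smul_eq_nsmul]
  change (normConst n k)⁻¹ • ∑ b ∈ words n k, letterVec n b = _
  rw [h, ← normConst_mul_self, smul_smul, inv_mul_cancel_left₀ (normConst_ne_zero n k)]

theorem tprod_eq_sum_letterVec {n : ℕ} (v : Fin n → Fin 2 → ℂ) :
    (⨂ₛ[ℂ] j, v j) = ∑ a : Fin n → Fin 2, (∏ j, v j (a j)) • letterVec n a := by
  have hv : v = fun j => ∑ x, v j x • (Pi.single x 1 : Fin 2 → ℂ) := by
    funext j
    exact pi_eq_sum_univ' (v j)
  conv_lhs => rw [hv]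
  rw [MultilinearMap.map_sum]
  refine Finset.sum_congr rfl fun a _ => ?_
  rw [MultilinearMap.map_smul_univ]
  rfl

theorem hom_ext_basisVec {n : ℕ} {E : Type} [AddCommGroup E] [Module ℂ E] {f g : V n →ₗ[ℂ] E}
    (h : ∀ k, f (basisVec n k) = g (basisVec n k)) : f = g := by
  have hl : ∀ a, f (letterVec n a) = g (letterVec n a) := by
    intro a
    obtain ⟨k, hk⟩ := exists_mem_words a
    have := h k
    rw [basisVec_eq_smul_letterVec hk, map_smul, map_smul] at this
    exact (smul_right_injective E (normConst_ne_zero n k)) this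
  refine LinearMap.ext_on_range (SymmetricPower.span_tprod_eq_top ℂ (Fin n) (Fin 2 → ℂ)) fun v => ?_
  rw [tprod_eq_sum_letterVec v]
  simp only [map_sum, map_smul, hl]

/-! ### Coequivariant maps and invariants -/

theorem rho_letterVec (n : ℕ) (w : SU2) (a : Fin n → Fin 2) :
    rho n w (letterVec n a) = ∑ b : Fin n → Fin 2, (∏ j, w.1 (a j) (b j)) • letterVec n b := by
  rw [rho, letterVec, symMap_tprod, tprod_eq_sum_letterVec]
  refine Finset.sum_congr rfl fun b _ => ?_
  congr 1
  refine Finset.prod_congr rfl fun j _ => ?_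
  rw [Matrix.vecMulLinear_apply, Matrix.single_one_vecMul]
  rfl

theorem action_ketTensor (θ : ℝ) (n : ℕ) (w : SU2) (a : Fin n → Fin 2) (i : Fin n → Fin 4) :
    action θ w (ketTensor n θ a i) =
      ∑ b : Fin n → Fin 2, (∏ j, w.1 (b j) (a j)) • ketTensor n θ b i := by
  have h := MultilinearMap.map_sum (MultilinearMap.mkPiAlgebraFin ℂ n (A7 θ))
    fun j (b : Fin 2) => w.1 b (a j) • ketPsi θ b (i j)
  simp only [MultilinearMap.mkPiAlgebraFin_apply, MultilinearMap.map_smul_univ] at h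
  rw [ketTensor, map_list_prod, List.map_ofFn]
  simp only [Function.comp_def, action_ketPsi]
  exact h

theorem sum_ketPhi_mul_eq (θ : ℝ) (n : ℕ) (f : V n →ₗ[ℂ] A7 θ) (i : Fin n → Fin 4) :
    ∑ k, ketPhi n θ k i * f (basisVec n k) = ∑ a, ketTensor n θ a i * f (letterVec n a) := by
  rw [← sum_sum_words]
  refine Finset.sum_congr rfl fun k _ => ?_
  rw [ketPhi, smul_mul_assoc, Finset.sum_mul, Finset.smul_sum]
  refine Finset.sum_congr rfl fun a ha => ?_
  rw [basisVec_eq_smul_letterVec ha, map_smul, mul_smul_comm, smul_smul,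
    inv_mul_cancel₀ (normConst_ne_zero n k), one_smul]

/-- The components of `∑_k |φ_k⟩ f(e_k)`, for a coequivariant map `f`, are invariant: this is the
pairing of a representation with its contragredient. -/
theorem action_sum_ketPhi_mul {θ : ℝ} {n : ℕ} {f : V n →ₗ[ℂ] A7 θ} (hf : f ∈ coequivariant n θ)
    (i : Fin n → Fin 4) (w : SU2) : action θ w (∑ k, ketPhi n θ k i * f (basisVec n k)) =
      ∑ k, ketPhi n θ k i * f (basisVec n k) := by
  have hw : w.1 * w⁻¹.1 = 1 := congrArg Subtype.val (mul_inv_cancel w)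
  have horth : ∀ b c : Fin n → Fin 2,
      ∑ a : Fin n → Fin 2, (∏ j, w.1 (b j) (a j)) * (∏ j, w⁻¹.1 (a j) (c j)) =
        if b = c then 1 else 0 := by
    intro b c
    simp only [← Finset.prod_mul_distrib]
    rw [← Fintype.piFinset_univ, ← Finset.prod_univ_sum (fun _ => Finset.univ)
      fun j x => w.1 (b j) x * w⁻¹.1 x (c j)]
    simp only [← Matrix.mul_apply, hw, Matrix.one_apply]
    rw [Fintype.prod_ite_zero]
    simp [funext_iff]
  rw [sum_ketPhi_mul_eq, map_sum]
  have hterm : ∀ a : Fin n → Fin 2, action θ w (ketTensor n θ a i * f (letterVec n a)) =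
      ∑ b : Fin n → Fin 2, ∑ c : Fin n → Fin 2,
        ((∏ j, w.1 (b j) (a j)) * (∏ j, w⁻¹.1 (a j) (c j))) •
          (ketTensor n θ b i * f (letterVec n c)) := by
    intro a
    rw [map_mul, ← hf w, rho_letterVec, action_ketTensor, map_sum, Finset.sum_mul_sum]
    simp only [map_smul, smul_mul_smul_comm]
  simp only [hterm]
  rw [Finset.sum_comm]
  refine Finset.sum_congr rfl fun b _ => ?_
  rw [Finset.sum_comm]
  simp only [← Finset.sum_smul, horth, ite_smul, one_smul, zero_smul, Finset.sum_ite_eq,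
    Finset.mem_univ, if_true]

/-! ### The bras as coequivariant maps -/

/-- The map `v ↦ v_1 (ψ_1)_i^* + v_2 (ψ_2)_i^*`. -/
def braLin (θ : ℝ) (i : Fin 4) : (Fin 2 → ℂ) →ₗ[ℂ] A7 θ :=
  Fintype.linearCombination ℂ fun a => star (ketPsi θ a i)

theorem braLin_vecMul_inv (θ : ℝ) (i : Fin 4) (w : SU2) (v : Fin 2 → ℂ) :
    braLin θ i (v ᵥ* w⁻¹.1) = action θ w (braLin θ i v) := by
  have hw : w⁻¹.1 = star w.1 := rfl
  simp only [braLin, Fintype.linearCombination_apply, Fin.sum_univ_two, map_add, map_smul, action_star,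
    action_ketPsi, star_add, star_smul, hw, Matrix.vecMul, dotProduct, Matrix.star_apply]
  module

/-- The multilinear map on `ℂ²` that sends `(e_{a_1}, …, e_{a_n})` to the adjoint of
`(ψ_{a_1})_{i_1} ⋯ (ψ_{a_n})_{i_n}`; its values are products in reversed order. -/
def braMultilinear (n : ℕ) (θ : ℝ) (i : Fin n → Fin 4) :
    MultilinearMap ℂ (fun _ : Fin n => Fin 2 → ℂ) (A7 θ) :=
  (MulOpposite.opLinearEquiv ℂ (M := A7 θ)).symm.toLinearMap.compMultilinearMap
    ((MultilinearMap.mkPiAlgebraFin ℂ n (A7 θ)ᵐᵒᵖ).compLinearMap fun j =>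
      (MulOpposite.opLinearEquiv ℂ).toLinearMap ∘ₗ braLin θ (i j))

theorem braMultilinear_apply (n : ℕ) (θ : ℝ) (i : Fin n → Fin 4) (v : Fin n → Fin 2 → ℂ) :
    braMultilinear n θ i v =
      MulOpposite.unop (List.ofFn fun j => MulOpposite.op (braLin θ (i j) (v j))).prod := by
  simp [braMultilinear]

theorem braMultilinear_single (n : ℕ) (θ : ℝ) (i : Fin n → Fin 4) (a : Fin n → Fin 2) :
    braMultilinear n θ i (fun j => Pi.single (a j) 1) = star (ketTensor n θ a i) := by
  have h := map_list_prod (starMulEquiv (R := A7 θ)) (List.ofFn fun j => ketPsi θ (a j) (i j))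
  rw [List.map_ofFn] at h
  rw [braMultilinear_apply, ketTensor]
  refine MulOpposite.op_injective (Eq.trans ?_ h.symm)
  rw [MulOpposite.op_unop]
  congr 2
  funext j
  simp [braLin, Fintype.linearCombination_apply_single]

theorem braMultilinear_vecMul_inv (n : ℕ) (θ : ℝ) (i : Fin n → Fin 4) (w : SU2)
    (v : Fin n → Fin 2 → ℂ) :
    braMultilinear n θ i (fun j => v j ᵥ* w⁻¹.1) = action θ w (braMultilinear n θ i v) := by
  have h := map_list_prod (AlgHom.op (action θ w))
    (List.ofFn fun j => MulOpposite.op (braLin θ (i j) (v j)))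
  rw [List.map_ofFn] at h
  rw [braMultilinear_apply, braMultilinear_apply]
  refine MulOpposite.op_injective (Eq.trans ?_ h.symm)
  rw [MulOpposite.op_unop]
  congr 2
  funext j
  rw [braLin_vecMul_inv]
  rfl

/-- The coequivariant map `e_k ↦ (φ_k)_i^*`. -/
def braMap (n : ℕ) (θ : ℝ) (i : Fin n → Fin 4) : coequivariant n θ :=
  ⟨symLift (braMultilinear n θ i), by
    intro w x
    have h : symLift (braMultilinear n θ i) ∘ₗ rho n w⁻¹ =
        (action θ w).toLinearMap ∘ₗ symLift (braMultilinear n θ i) := by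
      refine LinearMap.ext_on_range (SymmetricPower.span_tprod_eq_top ℂ (Fin n) (Fin 2 → ℂ)) fun v => ?_
      rw [LinearMap.comp_apply, LinearMap.comp_apply, rho, symMap_tprod, symLift_tprod,
        symLift_tprod, map_smul, map_sum]
      congr 1
      exact Finset.sum_congr rfl fun σ _ => braMultilinear_vecMul_inv n θ i w (v ∘ σ)
    exact LinearMap.congr_fun h x⟩

theorem braMap_basisVec (n : ℕ) (θ : ℝ) (i : Fin n → Fin 4) (k : Fin (n + 1)) :
    (braMap n θ i : V n →ₗ[ℂ] A7 θ) (basisVec n k) = star (ketPhi n θ k i) := by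
  have hperm : ∀ σ : Equiv.Perm (Fin n), ∑ a ∈ words n k, star (ketTensor n θ (a ∘ σ) i) =
      ∑ a ∈ words n k, star (ketTensor n θ a i) := by
    intro σ
    refine Finset.sum_equiv (Equiv.arrowCongr σ.symm (Equiv.refl _)) (fun a => ?_) fun a _ => rfl
    have : (Finset.univ.filter fun j => a (σ j) = 1).card =
        (Finset.univ.filter fun j => a j = 1).card :=
      Finset.card_equiv σ (by simp)
    simp [words, ← this, Function.comp_def]
  change symLift (braMultilinear n θ i) _ = _
  rw [basisVec, map_smul, map_sum]
  simp only [symLift_tprod]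
  rw [← Finset.smul_sum, Finset.sum_comm]
  have hterm : ∀ σ : Equiv.Perm (Fin n), ∑ a ∈ words n k,
      braMultilinear n θ i ((fun j => (Pi.single (a j) 1 : Fin 2 → ℂ)) ∘ σ) =
        ∑ a ∈ words n k, star (ketTensor n θ a i) := fun σ => by
    rw [← hperm σ]
    exact Finset.sum_congr rfl fun a _ => braMultilinear_single n θ i (a ∘ σ)
  rw [Finset.sum_congr rfl fun σ _ => hterm σ, Finset.sum_const, Finset.card_univ,
    Fintype.card_perm, Fintype.card_fin, ← Nat.cast_smul_eq_nsmul ℂ, smul_smul,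
    smul_smul, mul_assoc, inv_mul_cancel₀ (Nat.cast_ne_zero.2 n.factorial_ne_zero), mul_one, ketPhi, star_smul, star_sum,
    star_inv₀, star_normConst]

/-! ### Orthonormality of the kets -/

/-- In the product of the adjoint with the tensor, the innermost factors contract first. -/
theorem sum_star_ketTensor_mul (n : ℕ) (θ : ℝ) (a b : Fin n → Fin 2) :
    ∑ i, star (ketTensor n θ a i) * ketTensor n θ b i = if a = b then 1 else 0 := by
  induction n with
  | zero => simp [ketTensor, Subsingleton.elim a b]
  | succ n ih =>
    have hcons : ∀ (c : Fin (n + 1) → Fin 2) (x : Fin 4) (i : Fin n → Fin 4),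
        ketTensor (n + 1) θ c (Fin.cons x i) =
          ketPsi θ (c 0) x * ketTensor n θ (Fin.tail c) i := by
      intro c x i
      simp [ketTensor, List.ofFn_succ, Fin.tail]
    rw [← (Fin.consEquiv fun _ => Fin 4).sum_comp, Fintype.sum_prod_type_right]
    simp only [Fin.consEquiv, Equiv.coe_fn_mk, hcons, star_mul]
    have hterm : ∀ i : Fin n → Fin 4, ∑ x, star (ketTensor n θ (Fin.tail a) i) *
        star (ketPsi θ (a 0) x) * (ketPsi θ (b 0) x * ketTensor n θ (Fin.tail b) i) =
          if a 0 = b 0 then star (ketTensor n θ (Fin.tail a) i) * ketTensor n θ (Fin.tail b) i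
            else 0 := by
      intro i
      have : ∀ x, star (ketTensor n θ (Fin.tail a) i) *
          star (ketPsi θ (a 0) x) * (ketPsi θ (b 0) x * ketTensor n θ (Fin.tail b) i) =
            star (ketTensor n θ (Fin.tail a) i) * (star (ketPsi θ (a 0) x) * ketPsi θ (b 0) x) *
              ketTensor n θ (Fin.tail b) i := fun x => by simp only [mul_assoc]
      simp only [this]
      rw [← Finset.sum_mul, ← Finset.mul_sum, sum_star_ketPsi_mul_ketPsi]
      split_ifs <;> simp
    simp only [hterm]
    by_cases h0 : a 0 = b 0
    · simp only [h0, if_true, ih]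
      congr 1
      rw [← Fin.cons_self_tail a, ← Fin.cons_self_tail b, Fin.tail_cons, Fin.tail_cons, h0,
        Fin.cons_inj]
      simp
    · have : a ≠ b := fun h => h0 (by rw [h])
      simp [h0, this]

theorem sum_star_ketPhi_mul (n : ℕ) (θ : ℝ) (k l : Fin (n + 1)) :
    ∑ i, star (ketPhi n θ k i) * ketPhi n θ l i = if k = l then 1 else 0 := by
  simp only [ketPhi, star_smul, star_sum, star_inv₀, star_normConst, smul_mul_smul_comm,
    Finset.sum_mul_sum]
  rw [← Finset.smul_sum, Finset.sum_comm]
  have hterm : ∀ a ∈ words n k, ∑ i, ∑ b ∈ words n l, star (ketTensor n θ a i) * ketTensor n θ b i =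
      if k = l then 1 else 0 := by
    intro a ha
    rw [Finset.sum_comm]
    simp only [sum_star_ketTensor_mul, Finset.sum_ite_eq]
    refine if_congr ?_ rfl rfl
    simp only [words, Finset.mem_filter, Finset.mem_univ, true_and] at ha ⊢
    rw [ha, Fin.val_inj]
  rw [Finset.sum_congr rfl hterm, Finset.sum_const, ← Nat.cast_smul_eq_nsmul ℂ, smul_smul]
  split_ifs with h
  · subst h
    rw [← mul_inv, normConst_mul_self, inv_mul_cancel₀ (card_words_ne_zero n k), one_smul]
  · rw [smul_zero]

/-- By orthonormality, `⟨φ_k | f⟩` recovers the coefficient `y_k` of `f = ∑_k |φ_k⟩ y_k`. -/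
theorem braPhi_eq_of_hopf_eq {n : ℕ} {θ : ℝ} {f : (Fin n → Fin 4) → A4 θ} {y : Fin (n + 1) → A7 θ}
    (h : ∀ i, hopf θ (f i) = ∑ k, ketPhi n θ k i * y k) (k : Fin (n + 1)) :
    braPhi n θ k f = y k := by
  simp only [braPhi, h, Finset.mul_sum, ← mul_assoc]
  rw [Finset.sum_comm]
  simp only [← Finset.sum_mul, sum_star_ketPhi_mul, ite_mul, one_mul, zero_mul, Finset.sum_ite_eq,
    Finset.mem_univ, if_true]

/-- The coequivariant map `e_k ↦ ⟨φ_k | f⟩`, as a module map in `f`. -/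
def braPairing (n : ℕ) (θ : ℝ) :
    ((Fin n → Fin 4) → A4 θ) →ₗ[(A4 θ)ᵐᵒᵖ] coequivariant n θ where
  toFun f := ∑ i, MulOpposite.op (f i) • braMap n θ i
  map_add' f g := by
    simp only [Pi.add_apply, MulOpposite.op_add, add_smul, Finset.sum_add_distrib]
  map_smul' a f := by
    rw [RingHom.id_apply, Finset.smul_sum]
    refine Finset.sum_congr rfl fun i _ => ?_
    rw [smul_smul]
    rfl

theorem braPairing_basisVec (n : ℕ) (θ : ℝ) (f : (Fin n → Fin 4) → A4 θ) (k : Fin (n + 1)) :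
    (braPairing n θ f : V n →ₗ[ℂ] A7 θ) (basisVec n k) = braPhi n θ k f := by
  change ((∑ i, MulOpposite.op (f i) • braMap n θ i : coequivariant n θ) : V n →ₗ[ℂ] A7 θ) _ = _
  rw [AddSubmonoidClass.coe_finsetSum, LinearMap.sum_apply]
  refine Finset.sum_congr rfl fun i _ => ?_
  rw [← braMap_basisVec]
  rfl

end NCHopf

end

theorem mainTheorem4 (n : ℕ) (θ : ℝ) :
    Function.Injective (NCHopf.hopf θ) ∧
    ∃ p : Matrix (Fin n → Fin 4) (Fin n → Fin 4) (NCHopf.A4 θ),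
      (∀ i j, NCHopf.hopf θ (p i j) =
        ∑ k, NCHopf.ketPhi n θ k i * star (NCHopf.ketPhi n θ k j)) ∧
      p * p = p ∧ pᴴ = p ∧
      ∃ Φ : NCHopf.imageModule p ≃ₗ[(NCHopf.A4 θ)ᵐᵒᵖ] NCHopf.coequivariant n θ,
        ∀ (f : (Fin n → Fin 4) → NCHopf.A4 θ) (k : Fin (n + 1)),
          (Φ ⟨p *ᵥ f, f, rfl⟩ : NCHopf.V n →ₗ[ℂ] NCHopf.A7 θ) (NCHopf.basisVec n k) =
            NCHopf.braPhi n θ k f := by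
  open NCHopf in
  have hinj := hopf_injective θ
  refine ⟨hinj, ?_⟩
  have hcomp : ∀ φ : coequivariant n θ, ∃ g : (Fin n → Fin 4) → A4 θ, ∀ i,
      hopf θ (g i) = ∑ k, ketPhi n θ k i * (φ : V n →ₗ[ℂ] A7 θ) (basisVec n k) := fun φ =>
    Classical.axiomOfChoice fun i => exists_hopf_eq_of_invariant (action_sum_ketPhi_mul φ.2 i)
  choose g hg using hcomp
  -- the `j`-th column of the projection comes from the coequivariant map `e_k ↦ (φ_k)_j^*`
  let p : Matrix (Fin n → Fin 4) (Fin n → Fin 4) (A4 θ) := fun i j => g (braMap n θ j) i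
  have hp : ∀ i j, hopf θ (p i j) = ∑ k, ketPhi n θ k i * star (ketPhi n θ k j) := fun i j => by
    simp only [p, hg, braMap_basisVec]
  have hpf : ∀ f i, hopf θ ((p *ᵥ f) i) = ∑ k, ketPhi n θ k i * braPhi n θ k f := by
    intro f i
    simp only [Matrix.mulVec, dotProduct, map_sum, map_mul, hp, braPhi, Finset.sum_mul,
      Finset.mul_sum, mul_assoc]
    exact Finset.sum_comm
  have hbra : ∀ f k, braPhi n θ k (p *ᵥ f) = braPhi n θ k f := fun f k =>
    braPhi_eq_of_hopf_eq (hpf f) k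
  refine ⟨p, hp, ?_, ?_, ?_⟩
  · ext i j
    refine hinj ?_
    change hopf θ ((p *ᵥ fun l => p l j) i) = _
    rw [hpf, hp]
    exact Finset.sum_congr rfl fun k _ => by rw [braPhi_eq_of_hopf_eq fun i => hp i j]
  · ext i j
    refine hinj ?_
    rw [Matrix.conjTranspose_apply, hopf_star, hp, hp, star_sum]
    exact Finset.sum_congr rfl fun k _ => by rw [star_mul, star_star]
  · have hΦ : ∀ f k, (((braPairing n θ).domRestrict (imageModule p) ⟨p *ᵥ f, f, rfl⟩ :
        coequivariant n θ) : V n →ₗ[ℂ] A7 θ) (basisVec n k) = braPhi n θ k f := fun f k =>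
      (braPairing_basisVec n θ (p *ᵥ f) k).trans (hbra f k)
    refine ⟨LinearEquiv.ofBijective ((braPairing n θ).domRestrict (imageModule p)) ⟨?_, ?_⟩, hΦ⟩
    · rw [injective_iff_map_eq_zero]
      rintro ⟨_, f, rfl⟩ h0
      refine Subtype.ext (funext fun i => hinj ?_)
      change hopf θ ((p *ᵥ f) i) = hopf θ 0
      rw [hpf, map_zero]
      refine Finset.sum_eq_zero fun k _ => ?_
      rw [← hΦ f k, h0]
      exact mul_zero _
    · intro φ
      refine ⟨⟨p *ᵥ g φ, g φ, rfl⟩, Subtype.ext (hom_ext_basisVec fun k => ?_)⟩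
      rw [hΦ]
      exact braPhi_eq_of_hopf_eq (hg φ) k
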